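/- Let $\mathbb B=\{0,1\}$ and let $\square$ be a blank symbol. A \emph{tape} is one-way infinite with cells $1,2,3,\dots$, each containing an element of $\mathbb B\cup\{\square\}$, all but finitely many being $\square$, together with a head position. A \emph{basic instruction} $f.p/(q,d)$, with $p:\mathbb B\cup\{\square\}\to\mathbb B$, $q:\mathbb B\cup\{\square\}\to\mathbb B\cup\{\square\}$, $d\in\{-1,0,1\}$, acts on the tape named $f$: if the cell under the head (cell $i$) contains $b$, the reply is $p(b)$, the content becomes $q(b)$, and the head moves to cell $\max(i+d,1)$. On tape $1$, $\mathsf{test}{:}b$ replies $1$ iff the cell under the head contains $b$ and changes nothing, and $\mathsf{set}{:}b{:}d$ writes $b$, moves the head by $d$ and replies $1$. Instruction sequences are built by concatenation $;$ and infinite repetition $(\cdot)^\omega$ from the primitive instructions $a$, $+a$, $-a$ ($a$ a basic instruction), $\#l$ ($l\in\mathbb N$) and $!$. Here $a$ performs $a$ and proceeds with the next instruction; $+a$ performs $a$ and proceeds with the next instruction if the reply is $1$ and otherwise skips it; $-a$ does the same with the roles of the replies exchanged; $\#l$ jumps to the $l$-th next instruction; $!$ terminates; and $\#0$, an infinite chain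 of jumps, or the absence of an instruction to proceed with gives inaction. The thread $|t|$ is the (possibly infinite) behaviour so produced by $t$. For a family $u$ of named tapes, $|t|\mathbin{/}u$ is the thread that results from performing the actions of $|t|$ on the tapes in $u$: each action on an available tape becomes an internal action $\mathsf{tau}$ and its reply selects how to proceed. $|t|\bullet u$ is the family of tapes that results on termination, and the empty family if $|t|$ does not terminate on $u$ or performs an action on a tape that is not available. The depth of a thread is the maximal number of actions (internal ones included) that it can perform. The term $t$ \emph{computes} $F:\mathbb B^*\to\mathbb B$ \emph{in time} $T:\mathbb N\to\mathbb N$ if for some $k\ge 1$ such that $t$ uses only tapes named $1,\dots,k$ the following holds for all $w\in\mathbb B^*$: if $u_w$ is the family of tapes $1,\dots,k$ with $w$ on tape $1$ (starting in cell $1$), all other cells of all tapes blank, and all heads on cell $1$, then $|t|\bullet u_w$ consists of tapes $1,\dots,k$ such that tape $k$ has its head on cell $1$, the bit $F(w)$ in cell $1$ and blanks in all other cells, and the depth of $|t|\mathbin{/}u_w$ is at most $T(|w|)$. A \emph{single-tape Turing-machine program} is a term $(t_1;\dots;t_n)^\omega$, $n\ge1$, where each $t_i$ has the form \[ \begin{aligned}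 &-\mathsf{test}{:}0\,;\,\#3\,;\,\mathsf{set}{:}b_0{:}d_0\,;\,u_0\,;\\ &-\mathsf{test}{:}1\,;\,\#3\,;\,\mathsf{set}{:}b_1{:}d_1\,;\,u_1\,;\\ &-\mathsf{test}{:}\square\,;\,\#3\,;\,\mathsf{set}{:}b_\square{:}d_\square\,;\,u_\square \end{aligned} \] with $b_0,b_1,b_\square\in\mathbb B\cup\{\square\}$, $d_0,d_1,d_\square\in\{-1,0,1\}$, and each of $u_0,u_1,u_\square$ is $\#0$, or $!$, or a jump $\#l$ with $l=12i+9$ for $u_0$, $l=12i+5$ for $u_1$, $l=12i+1$ for $u_\square$, for some $0\le i<n$. Let $\mathbf P$ be the class of all $F:\mathbb B^*\to\mathbb B$ (characteristic functions of languages over $\mathbb B$) that are decided, by accepting if $F(w)=1$ and rejecting if $F(w)=0$, within $T(|w|)$ steps for some polynomial function $T:\mathbb N\to\mathbb N$ by a deterministic Turing machine with a single one-way infinite tape and an arbitrary finite tape alphabet containing $0$, $1$ and $\square$. \textbf{Theorem.} $\mathbf P$ is equal to the class of all functions $F:\mathbb B^*\to\mathbb B$ for which there exist a single-tape Turing-machine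 program $t$ and a polynomial function $T:\mathbb N\to\mathbb N$ such that $t$ computes $F$ in time $T$. -/

import Mathlib

namespace PGA

/-! ## Turing tapes and basic instructions -/

/-- The tape alphabet `{0, 1, □}`: `some b` is the bit `b`, and `none` is the blank `□`. -/
abbrev Sym : Type := Option Bool

/-- The head moves `-1`, `0` and `1`. -/
inductive Dir : Type
  | left
  | stay
  | right

/-- The head position after a move. Cells are numbered from `0`, so a left move on the leftmost
cell leaves the head where it is. -/
def Dir.move : Dir → ℕ → ℕ
  | .left, i => i - 1
  | .stay, i => i
  | .right, i => i + 1

/-- A Turing-tape state: the contents of a one-way infinite tape with finitely many non-blank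
cells, and the head position. Cells are numbered from `0`. -/
@[ext] structure TapeState : Type where
  cells : ℕ → Sym
  head : ℕ
  finite : ∃ j, ∀ k, cells (j + k) = none

/-- The basic instruction `f.p/(q,d)` on the tape named `f`: the reply is `p b`, the content `b`
of the cell under the head is replaced by `q b`, and then the head is moved by `d`. -/
structure BInstr (Φ : Type) : Type where
  focus : Φ
  reply : Sym → Bool
  write : Sym → Sym
  dir : Dir

/-- The state of a tape after carrying out the operation of a basic instruction on it. -/
def TapeState.exec {Φ : Type} (s : TapeState) (a : BInstr Φ) : TapeState where
  cells := Function.update s.cells s.head (a.write (s.cells s.head))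
  head := a.dir.move s.head
  finite := by
    obtain ⟨j, hj⟩ := s.finite
    refine ⟨j + s.head + 1, fun k => ?_⟩
    rw [Function.update_of_ne (by omega)]
    have h := hj (s.head + 1 + k)
    rwa [show j + (s.head + 1 + k) = j + s.head + 1 + k by omega] at h

/-- The tape that holds the string `l` in its first cells and blanks elsewhere, with the head on
the first cell. -/
def TapeState.ofList (l : List Sym) : TapeState where
  cells := fun i => l.getD i none
  head := 0
  finite := ⟨l.length, fun k => by simp⟩

/-- `f.test:b`. -/
def BInstr.test {Φ : Type} (f : Φ) (b : Sym) : BInstr Φ := ⟨f, fun c => decide (c = b), id, .stay⟩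

/-- `f.set:b:d`. -/
def BInstr.set {Φ : Type} (f : Φ) (b : Sym) (d : Dir) : BInstr Φ := ⟨f, fun _ => true, fun _ => b, d⟩

/-! ## Instruction sequences -/

/-- Primitive instructions. -/
inductive PInstr (Φ : Type) : Type
  | plain (a : BInstr Φ)
  | ptst (a : BInstr Φ)
  | ntst (a : BInstr Φ)
  | jmp (l : ℕ)
  | halt

/-- Closed terms of sort instruction sequence: instructions, concatenation and repetition. -/
inductive Term (Φ : Type) : Type
  | instr (u : PInstr Φ)
  | conc (t t' : Term Φ)
  | rep (t : Term Φ)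

/-- Finite and infinite sequences of primitive instructions. -/
inductive InSeq (Φ : Type) : Type
  | fin (l : List (PInstr Φ))
  | inf (s : ℕ → PInstr Φ)

namespace InSeq

variable {Φ : Type}

/-- The instruction at a position (counted from `0`), if there is one. -/
def get : InSeq Φ → ℕ → Option (PInstr Φ)
  | fin l, i => l[i]?
  | inf s, i => some (s i)

def conc : InSeq Φ → InSeq Φ → InSeq Φ
  | fin l, fin l' => fin (l ++ l')
  | fin l, inf s => inf fun i => l.getD i (s (i - l.length))
  | inf s, _ => inf s

/-- Infinite repetition. Only non-empty lists arise from terms, and for those the default value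
`halt` is never used. -/
def rep : InSeq Φ → InSeq Φ
  | fin l => inf fun i => l.getD (i % l.length) .halt
  | inf s => inf s

/-- `JumpsTo s i j`: execution of `s` from position `i` leads, through a finite (possibly empty)
chain of forward jumps `#l` with `l > 0`, to position `j`, where `s` has an instruction that is
not a jump. -/
inductive JumpsTo (s : InSeq Φ) : ℕ → ℕ → Prop
  | here {i : ℕ} {u : PInstr Φ} (h : s.get i = some u) (hu : ∀ l, u ≠ .jmp l) : JumpsTo s i i
  | jump {i j l : ℕ} (h : s.get i = some (.jmp (l + 1))) (hj : JumpsTo s (i + (l + 1)) j) :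
      JumpsTo s i j

open Classical in
/-- The position of the first non-jump instruction that is executed from position `i` on. There is
none after `#0`, after leaving the sequence, and in an infinite chain of jumps. -/
noncomputable def target (s : InSeq Φ) (i : ℕ) : Option ℕ :=
  if h : ∃ j, s.JumpsTo i j then some h.choose else none

end InSeq

namespace Term

variable {Φ : Type}

/-- The instruction sequence represented by a closed term. -/
def seq : Term Φ → InSeq Φ
  | instr u => .fin [u]
  | conc t t' => t.seq.conc t'.seq
  | rep t => t.seq.rep

end Term

/-- All basic instructions in the instruction have a focus in `A`. -/
def PInstr.FociIn {Φ : Type} (A : Set Φ) : PInstr Φ → Prop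
  | plain a => a.focus ∈ A
  | ptst a => a.focus ∈ A
  | ntst a => a.focus ∈ A
  | jmp _ => True
  | halt => True

/-- All foci that occur in the term belong to `A`. -/
def Term.FociIn {Φ : Type} (A : Set Φ) : Term Φ → Prop
  | instr u => u.FociIn A
  | conc t t' => t.FociIn A ∧ t'.FociIn A
  | rep t => t.FociIn A

/-! ## Turing-tape families -/

/-- What a family has under a given name: no tape, an inoperative tape, or a tape in a given
state. -/
inductive Entry : Type
  | absent
  | inoperative
  | operative (s : TapeState)

/-- Turing-tape families. -/
abbrev Family (Φ : Type) : Type := Φ → Entry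

namespace Family

variable {Φ : Type}

def empty : Family Φ := fun _ => .absent

/-- The family with just one tape, which is named `f` and has state `s`. -/
def single [DecidableEq Φ] (f : Φ) (s : TapeState) : Family Φ :=
  Function.update empty f (.operative s)

/-- Composition: two tapes with the same name collapse to an inoperative one. -/
def comp (u v : Family Φ) : Family Φ := fun f =>
  match u f, v f with
  | .absent, e => e
  | e, .absent => e
  | _, _ => .inoperative

/-- The composition of `u 1, …, u n`; the empty family for `n = 0`. -/
def compUpTo (u : ℕ → Family Φ) : ℕ → Family Φ
  | 0 => empty
  | n + 1 => (compUpTo u n).comp (u (n + 1))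

end Family

/-! ## Threads -/

/-- Finite threads: termination, inaction, the internal action followed by a thread, and
postconditional composition `x ⊴ a ⊵ y`, which performs `a` and proceeds as `x` on reply `1` and as
`y` on reply `0`. As the internal action always gives reply `1`, it has one continuation. -/
inductive FinThread (Φ : Type) : Type
  | term
  | dead
  | tau (x : FinThread Φ)
  | pcc (x : FinThread Φ) (a : BInstr Φ) (y : FinThread Φ)

namespace FinThread

variable {Φ : Type}

/-- The projection (approximation up to depth `n`). -/
def proj : ℕ → FinThread Φ → FinThread Φ
  | 0, _ => dead
  | _ + 1, term => term
  | _ + 1, dead => dead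
  | n + 1, tau x => tau (proj n x)
  | n + 1, pcc x a y => pcc (proj n x) a (proj n y)

def depth : FinThread Φ → ℕ
  | term => 0
  | dead => 0
  | tau x => x.depth + 1
  | pcc x _ y => max x.depth y.depth + 1

/-- The use operator on finite threads: every action on an operative tape of the family turns into
the internal action, and the reply selects the continuation. -/
def use [DecidableEq Φ] : FinThread Φ → Family Φ → FinThread Φ
  | term, _ => term
  | dead, _ => dead
  | tau x, u => tau (x.use u)
  | pcc x a y, u =>
    match u a.focus with
    | .absent => pcc (x.use u) a (y.use u)
    | .inoperative => dead
    | .operative s =>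
      tau (if a.reply (s.cells s.head) then x.use (Function.update u a.focus (.operative (s.exec a)))
        else y.use (Function.update u a.focus (.operative (s.exec a))))

/-- The apply operator on finite threads: the family that results on termination, and the empty
family if the thread does not terminate or needs an absent or inoperative tape. -/
def apply [DecidableEq Φ] : FinThread Φ → Family Φ → Family Φ
  | term, u => u
  | dead, _ => Family.empty
  | tau x, u => x.apply u
  | pcc x a y, u =>
    match u a.focus with
    | .absent => Family.empty
    | .inoperative => Family.empty
    | .operative s =>
      if a.reply (s.cells s.head) then x.apply (Function.update u a.focus (.operative (s.exec a)))
      else y.apply (Function.update u a.focus (.operative (s.exec a)))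

theorem proj_use [DecidableEq Φ] (n : ℕ) (x : FinThread Φ) (u : Family Φ) :
    (x.use u).proj n = (x.proj n).use u := by
  induction n generalizing x u with
  | zero => simp [proj, use]
  | succ n ih =>
    cases x with
    | term => simp [proj, use]
    | dead => simp [proj, use]
    | tau x => simp [proj, use, ih]
    | pcc x a y =>
      simp only [proj, use]
      cases u a.focus with
      | absent => simp [proj, ih]
      | inoperative => simp [proj]
      | operative s => simp only [proj]; split <;> simp [ih]

end FinThread

/-- Finite and infinite threads, in the projective limit model: a thread is the sequence of its
projections, so threads with the same projections are equal. -/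
@[ext] structure Thread (Φ : Type) : Type where
  approx : ℕ → FinThread Φ
  coherent : ∀ n, (approx (n + 1)).proj n = approx n

namespace Thread

variable {Φ : Type}

/-- The maximal number of actions that the thread can perform, `⊤` for infinite threads. -/
noncomputable def depth (x : Thread Φ) : ℕ∞ := ⨆ n, ((x.approx n).depth : ℕ∞)

/-- The use operator; it commutes with the projections. -/
def use [DecidableEq Φ] (x : Thread Φ) (u : Family Φ) : Thread Φ where
  approx := fun n => (x.approx n).use u
  coherent := fun n => by rw [FinThread.proj_use, x.coherent]

open Classical in
/-- The apply operator: the eventual value of apply on the projections of the thread. (This value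
always exists; it is the empty family if the thread does not terminate on the family.) -/
noncomputable def apply [DecidableEq Φ] (x : Thread Φ) (u : Family Φ) : Family Φ :=
  if h : ∃ v, ∀ᶠ n in Filter.atTop, (x.approx n).apply u = v then h.choose else Family.empty

end Thread

namespace InSeq

variable {Φ : Type}

/-- The projection up to depth `n` of the thread produced by executing `s` from position `i`. -/
noncomputable def extractApprox (s : InSeq Φ) : ℕ → ℕ → FinThread Φ
  | 0, _ => .dead
  | n + 1, i =>
    match s.target i with
    | none => .dead
    | some j =>
      match s.get j with
      | some (.plain a) => .pcc (extractApprox s n (j + 1)) a (extractApprox s n (j + 1))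
      | some (.ptst a) => .pcc (extractApprox s n (j + 1)) a (extractApprox s n (j + 2))
      | some (.ntst a) => .pcc (extractApprox s n (j + 2)) a (extractApprox s n (j + 1))
      | some .halt => .term
      | some (.jmp _) => .dead
      | none => .dead

theorem proj_extractApprox (s : InSeq Φ) (n i : ℕ) :
    (s.extractApprox (n + 1) i).proj n = s.extractApprox n i := by
  induction n generalizing i with
  | zero => simp [FinThread.proj, extractApprox]
  | succ n ih =>
    rw [extractApprox, extractApprox]
    cases s.target i with
    | none => simp [FinThread.proj]
    | some j =>
      dsimp only
      split <;> simp [FinThread.proj, ih]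

end InSeq

/-- Thread extraction. -/
noncomputable def Term.extract {Φ : Type} (t : Term Φ) : Thread Φ where
  approx := fun n => t.seq.extractApprox n 0
  coherent := fun n => t.seq.proj_extractApprox n 0

/-! ## Computing functions on bit strings

The tapes are named by `1, 2, 3, …`. -/

/-- The family of tapes `1, …, k` with `w₁ □ … □ wₙ` on tape `1`, all other tapes being empty, and
all heads on the first cell. -/
def inputFamily (k : ℕ) {n : ℕ} (w : Fin n → List Bool) : Family ℕ :=
  Family.compUpTo (fun j => Family.single j (TapeState.ofList
    (if j = 1 then [none].intercalate (List.ofFn fun i => (w i).map some) else []))) k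

/-- The term `t` computes the partial function `F` with `k` tapes in time `T`. -/
def ComputesWith (k : ℕ) (t : Term ℕ) {n : ℕ} (F : (Fin n → List Bool) →. List Bool)
    (T : ℕ → ℕ) : Prop :=
  t.FociIn (Set.Icc 1 k) ∧
  (∀ w, ∀ y ∈ F w,
    (∃ s : ℕ → TapeState, t.extract.apply (inputFamily k w) =
      (Family.compUpTo (fun j => Family.single j (s j)) (k - 1)).comp
        (Family.single k (TapeState.ofList (y.map some)))) ∧
    (t.extract.use (inputFamily k w)).depth ≤ T (∑ i, (w i).length)) ∧
  (∀ w, ¬ (F w).Dom → t.extract.apply (inputFamily k w) = Family.empty)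

/-- The term `t` computes the partial function `F` in time `T`. -/
def ComputesInTime (t : Term ℕ) {n : ℕ} (F : (Fin n → List Bool) →. List Bool)
    (T : ℕ → ℕ) : Prop :=
  ∃ k, 1 ≤ k ∧ ComputesWith k t F T

/-- A total function from bit strings to bits as a unary partial function on bit strings. -/
def ofDecision (F : List Bool → Bool) : (Fin 1 → List Bool) →. List Bool :=
  fun w => Part.some [F (w 0)]

/-- The functions from `ℕ` to `ℕ` that are polynomial functions. -/
def poly : Set (ℕ → ℕ) := {T | ∃ p : Polynomial ℝ, ∀ n : ℕ, (T n : ℝ) = p.eval (n : ℝ)}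

/-! ## Single-tape Turing-machine programs -/

/-- The instruction is `#(12 i + c)` with `i < n`, or `#0`, or the termination instruction. -/
def IsExit (n c : ℕ) (u : PInstr ℕ) : Prop :=
  (∃ i < n, u = .jmp (12 * i + c)) ∨ u = .jmp 0 ∨ u = .halt

/-- The twelve instructions of one of the `n` parts of a single-tape Turing-machine program. -/
def IsBlock (n : ℕ) (l : List (PInstr ℕ)) : Prop :=
  ∃ (b₀ b₁ b₂ : Sym) (d₀ d₁ d₂ : Dir) (u₀ u₁ u₂ : PInstr ℕ),
    IsExit n 9 u₀ ∧ IsExit n 5 u₁ ∧ IsExit n 1 u₂ ∧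
    l = [.ntst (.test 1 (some false)), .jmp 3, .plain (.set 1 b₀ d₀), u₀,
         .ntst (.test 1 (some true)), .jmp 3, .plain (.set 1 b₁ d₁), u₁,
         .ntst (.test 1 none), .jmp 3, .plain (.set 1 b₂ d₂), u₂]

/-- The single-tape Turing-machine programs: the terms `(t₁ ; … ; tₙ)^ω` with `n ≥ 1` such that
each `tᵢ` is a block, where concatenations may be bracketed in any way. -/
def TMPrograms : Set (Term ℕ) :=
  {t | ∃ (t' : Term ℕ) (bs : List (List (PInstr ℕ))), t = .rep t' ∧ bs ≠ [] ∧
    (∀ l ∈ bs, IsBlock bs.length l) ∧ t'.seq = .fin bs.flatten}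

/-! ## The complexity class P -/

/-- Deterministic Turing machines with a single one-way infinite tape, an arbitrary finite tape
alphabet `Γ` that contains the bits and a blank, a finite set `Q` of states, and the option not to
move the head. -/
structure TuringMachine : Type 1 where
  Q : Type
  Γ : Type
  finQ : Finite Q
  finΓ : Finite Γ
  bit : Bool → Γ
  blank : Γ
  bit_injective : Function.Injective bit
  bit_ne_blank : ∀ b, bit b ≠ blank
  start : Q
  accept : Q
  reject : Q
  accept_ne_reject : accept ≠ reject
  δ : Q → Γ → Q × Γ × Dir

namespace TuringMachine

structure Cfg (M : TuringMachine) : Type where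
  state : M.Q
  tape : ℕ → M.Γ
  head : ℕ

open Classical in
/-- One step; configurations in the accepting or the rejecting state are final. -/
noncomputable def step (M : TuringMachine) (c : M.Cfg) : M.Cfg :=
  if c.state = M.accept ∨ c.state = M.reject then c
  else
    { state := (M.δ c.state (c.tape c.head)).1
      tape := Function.update c.tape c.head (M.δ c.state (c.tape c.head)).2.1
      head := (M.δ c.state (c.tape c.head)).2.2.move c.head }

/-- The start configuration on an input. -/
def startCfg (M : TuringMachine) (w : List Bool) : M.Cfg where
  state := M.start
  tape := fun i => (w.map M.bit).getD i M.blank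
  head := 0

/-- On each input `w`, after at most `T |w|` steps the machine has accepted if `F w = 1` and has
rejected if `F w = 0`. -/
def DecidesInTime (M : TuringMachine) (F : List Bool → Bool) (T : ℕ → ℕ) : Prop :=
  ∀ w, ∃ m ≤ T w.length,
    (M.step^[m] (M.startCfg w)).state = if F w then M.accept else M.reject

end TuringMachine

/-- The complexity class `P`, languages over `{0, 1}` being given by their characteristic
functions. -/
def ClassP : Set (List Bool → Bool) :=
  {F | ∃ (M : TuringMachine), ∃ T ∈ poly, M.DecidesInTime F T}

end PGA

/-!
A program `(t₁; …; tₙ)^ω` is a finite automaton on a tape over `{0, 1, □}`: block `i` is a state,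
and its exits are relative jumps, which are cyclic modulo `n`, so that every block can be reached
from every block. One automaton step takes between one and four actions; hence time bounds agree up
to a constant factor, and a Turing machine is obtained by reading the verdict off the first cell.

Conversely, a Turing machine with an arbitrary tape alphabet is simulated by such an automaton on
codes of symbols by bit strings of the same length. The input is converted bit by bit, which takes
quadratic time. The blanks that are left where the input was mark the left end of the simulated
tape. To produce the output, the codes are erased and the head has to find the first cell of the
real tape: a left move there does not move the head, and so a bit that is written before the move
is still under the head after it.
-/

namespace PGA

/-! ## Execution of instruction sequences -/

namespace FinThread

variable {Φ : Type}

theorem depth_proj_le (n : ℕ) (x : FinThread Φ) : (x.proj n).depth ≤ n := by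
  induction n generalizing x with
  | zero => simp [proj, depth]
  | succ n ih => cases x <;> simp [proj, depth, ih]

variable [DecidableEq Φ] {u : Family Φ} {a : BInstr Φ} {t : TapeState}

theorem use_pcc_operative (x y : FinThread Φ) (hu : u a.focus = .operative t) :
    (pcc x a y).use u = tau ((if a.reply (t.cells t.head) then x else y).use
      (Function.update u a.focus (.operative (t.exec a)))) := by
  simp only [use, hu]
  split <;> rfl

theorem apply_pcc_operative (x y : FinThread Φ) (hu : u a.focus = .operative t) :
    (pcc x a y).apply u = (if a.reply (t.cells t.head) then x else y).apply
      (Function.update u a.focus (.operative (t.exec a))) := by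
  simp only [apply, hu]
  split <;> rfl

end FinThread

namespace Thread

variable {Φ : Type}

theorem depth_approx_le (x : Thread Φ) (n : ℕ) : (x.approx n).depth ≤ n := by
  rw [← x.coherent]
  exact FinThread.depth_proj_le _ _

theorem apply_eq_of_eventually [DecidableEq Φ] {x : Thread Φ} {u v : Family Φ}
    (h : ∀ᶠ n in Filter.atTop, (x.approx n).apply u = v) : x.apply u = v := by
  have hex : ∃ v, ∀ᶠ n in Filter.atTop, (x.approx n).apply u = v := ⟨v, h⟩
  rw [Thread.apply, dif_pos hex]
  obtain ⟨n, h₁, h₂⟩ := (hex.choose_spec.and h).exists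
  exact h₁.symm.trans h₂

end Thread

namespace InSeq

variable {Φ : Type} {s : InSeq Φ} {i j l : ℕ} {a : BInstr Φ}

theorem JumpsTo.unique {j' : ℕ} (h : s.JumpsTo i j) (h' : s.JumpsTo i j') : j = j' := by
  induction h with
  | here h hu =>
    cases h' with
    | here => rfl
    | jump h₁ => cases h.symm.trans h₁; exact absurd rfl (hu _)
  | jump h _ ih =>
    cases h' with
    | here h₁ hu => cases h.symm.trans h₁; exact absurd rfl (hu _)
    | jump h₁ h₂ => cases h.symm.trans h₁; exact ih h₂

theorem JumpsTo.target_eq (h : s.JumpsTo i j) : s.target i = some j := by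
  have hex : ∃ j, s.JumpsTo i j := ⟨j, h⟩
  rw [target, dif_pos hex, hex.choose_spec.unique h]

theorem jumpsTo_jmp_succ_iff (h : s.get i = some (.jmp (l + 1))) :
    s.JumpsTo i j ↔ s.JumpsTo (i + (l + 1)) j := by
  refine ⟨fun hj => ?_, .jump h⟩
  cases hj with
  | here h₁ hu => cases h.symm.trans h₁; exact absurd rfl (hu _)
  | jump h₁ h₂ => cases h.symm.trans h₁; exact h₂

theorem not_jumpsTo_jmp_zero (h : s.get i = some (.jmp 0)) : ¬ s.JumpsTo i j := by
  rintro (⟨h₁, hu⟩ | ⟨h₁, -⟩)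
  · cases h.symm.trans h₁
    exact hu _ rfl
  · cases h.symm.trans h₁

theorem extractApprox_jmp_succ (h : s.get i = some (.jmp (l + 1))) (n : ℕ) :
    s.extractApprox n i = s.extractApprox n (i + (l + 1)) := by
  cases n with
  | zero => rfl
  | succ n =>
    have hjump : s.JumpsTo i = s.JumpsTo (i + (l + 1)) :=
      funext fun _ => propext (jumpsTo_jmp_succ_iff h)
    rw [extractApprox, extractApprox, target, target, hjump]

theorem extractApprox_jmp_zero (h : s.get i = some (.jmp 0)) (n : ℕ) :
    s.extractApprox n i = .dead := by
  cases n with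
  | zero => rfl
  | succ n => simp [extractApprox, target, not_jumpsTo_jmp_zero h]

theorem extractApprox_halt (h : s.get i = some .halt) (n : ℕ) :
    s.extractApprox (n + 1) i = .term := by
  simp [extractApprox, (JumpsTo.here h (by simp)).target_eq, h]

theorem extractApprox_plain (h : s.get i = some (.plain a)) (n : ℕ) :
    s.extractApprox (n + 1) i =
      .pcc (s.extractApprox n (i + 1)) a (s.extractApprox n (i + 1)) := by
  simp [extractApprox, (JumpsTo.here h (by simp)).target_eq, h]

theorem extractApprox_ntst (h : s.get i = some (.ntst a)) (n : ℕ) :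
    s.extractApprox (n + 1) i =
      .pcc (s.extractApprox n (i + 2)) a (s.extractApprox n (i + 1)) := by
  simp [extractApprox, (JumpsTo.here h (by simp)).target_eq, h]

variable [DecidableEq Φ] {c c' p p' p'' : ℕ} {u u' u'' : Family Φ} {t : TapeState}

/-- Execution of `s` from position `p` on the family `u` performs `c` actions on available tapes,
which lead to position `p'` and the family `u'`. It is phrased in terms of the observations `depth`
and `apply`, so that a position may be replaced by the one to which its jumps lead. -/
def Advances (s : InSeq Φ) (c p : ℕ) (u : Family Φ) (p' : ℕ) (u' : Family Φ) : Prop :=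
  ∀ n, ((s.extractApprox (n + c) p).use u).depth = ((s.extractApprox n p').use u').depth + c ∧
    (s.extractApprox (n + c) p).apply u = (s.extractApprox n p').apply u'

namespace Advances

theorem refl (s : InSeq Φ) (p : ℕ) (u : Family Φ) : s.Advances 0 p u p u :=
  fun _ => ⟨rfl, rfl⟩

theorem trans (h : s.Advances c p u p' u') (h' : s.Advances c' p' u' p'' u'') :
    s.Advances (c' + c) p u p'' u'' := by
  intro n
  rw [← add_assoc, (h _).1, (h _).2, (h' n).1, (h' n).2, add_assoc]
  exact ⟨rfl, rfl⟩

theorem congr_right (h : s.Advances c p u p' u')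
    (hp : ∀ n, s.extractApprox n p' = s.extractApprox n p'') : s.Advances c p u p'' u' := by
  intro n
  rw [← hp]
  exact h n

theorem ntst (h : s.get p = some (.ntst a)) (hu : u a.focus = .operative t) :
    s.Advances 1 p u (if a.reply (t.cells t.head) then p + 2 else p + 1)
      (Function.update u a.focus (.operative (t.exec a))) := by
  intro n
  rw [extractApprox_ntst h, FinThread.use_pcc_operative _ _ hu,
    FinThread.apply_pcc_operative _ _ hu]
  split <;> exact ⟨rfl, rfl⟩

theorem plain (h : s.get p = some (.plain a)) (hu : u a.focus = .operative t) :
    s.Advances 1 p u (p + 1) (Function.update u a.focus (.operative (t.exec a))) := by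
  intro n
  rw [extractApprox_plain h, FinThread.use_pcc_operative _ _ hu,
    FinThread.apply_pcc_operative _ _ hu, ite_self]
  exact ⟨rfl, rfl⟩

end Advances

end InSeq

namespace Term

variable {Φ : Type} [DecidableEq Φ] {t : Term Φ} {c p : ℕ} {u u' : Family Φ}

theorem le_depth_extract (h : t.seq.Advances c 0 u p u') : c ≤ (t.extract.use u).depth := by
  refine le_iSup_of_le (0 + c) ?_
  rw [show ((t.extract.use u).approx (0 + c)).depth = _ from (h 0).1]
  exact_mod_cast Nat.le_add_left _ _

theorem depth_extract_le_of_halt (h : t.seq.Advances c 0 u p u')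
    (hp : t.seq.get p = some .halt) : (t.extract.use u).depth ≤ c := by
  refine iSup_le fun n => Nat.cast_le.2 ?_
  rcases le_total n c with hn | hn
  · exact (Thread.depth_approx_le _ n).trans hn
  · obtain ⟨n, rfl⟩ := Nat.exists_eq_add_of_le' hn
    refine (h n).1.trans_le ?_
    cases n with
    | zero => simp [InSeq.extractApprox, FinThread.use, FinThread.depth]
    | succ n => simp [InSeq.extractApprox_halt hp, FinThread.use, FinThread.depth]

theorem apply_extract_of_halt (h : t.seq.Advances c 0 u p u')
    (hp : t.seq.get p = some .halt) : t.extract.apply u = u' := by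
  refine Thread.apply_eq_of_eventually ?_
  filter_upwards [Filter.eventually_ge_atTop (1 + c)] with n hn
  obtain ⟨n, rfl⟩ := Nat.exists_eq_add_of_le' hn
  rw [← add_assoc]
  refine (h (n + 1)).2.trans ?_
  rw [InSeq.extractApprox_halt hp]
  rfl

theorem apply_extract_of_jmp_zero (h : t.seq.Advances c 0 u p u')
    (hp : t.seq.get p = some (.jmp 0)) : t.extract.apply u = Family.empty := by
  refine Thread.apply_eq_of_eventually ?_
  filter_upwards [Filter.eventually_ge_atTop c] with n hn
  obtain ⟨n, rfl⟩ := Nat.exists_eq_add_of_le' hn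
  refine (h n).2.trans ?_
  rw [InSeq.extractApprox_jmp_zero hp]
  rfl

end Term

/-! ## Automata on a tape over `{0, 1, □}` -/

/-- What an automaton does after writing and moving: proceed with a state, terminate, or become
inactive. -/
inductive Exit (σ : Type) : Type
  | goto (q : σ)
  | halt
  | dead

/-- The map on exits induced by a map on states. -/
def Exit.map {σ τ : Type} (f : σ → τ) : Exit σ → Exit τ
  | goto q => goto (f q)
  | halt => halt
  | dead => dead

/-- The reaction of an automaton to a symbol: the symbol that replaces it, the head move, and the
way to proceed. -/
structure Rule (σ : Type) : Type where
  write : Sym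
  dir : Dir
  exit : Exit σ

/-- The map on rules induced by a map on states. -/
def Rule.map {σ τ : Type} (f : σ → τ) (r : Rule σ) : Rule τ := ⟨r.write, r.dir, r.exit.map f⟩

/-- Deterministic automata with states in `σ` that operate on one tape over `{0, 1, □}`. -/
abbrev Auto (σ : Type) : Type := σ → Sym → Rule σ

/-- The effect on a tape of writing `y` and moving by `d`. -/
def TapeState.writeMove (t : TapeState) (y : Sym) (d : Dir) : TapeState :=
  t.exec (BInstr.set () y d)

theorem TapeState.exec_test {Φ : Type} (t : TapeState) (f : Φ) (b : Sym) :
    t.exec (.test f b) = t := by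
  ext1
  · simp [TapeState.exec, BInstr.test]
  · rfl

/-- One step of an automaton; termination and inaction are final. -/
def Auto.step {σ : Type} (A : Auto σ) : Exit σ × TapeState → Exit σ × TapeState
  | (.goto q, t) =>
    ((A q (t.cells t.head)).exit,
      t.writeMove (A q (t.cells t.head)).write (A q (t.cells t.head)).dir)
  | x => x

theorem Auto.semiconj_step {σ τ : Type} {A : Auto σ} {B : Auto τ} {f : τ → σ}
    (h : ∀ q b, A (f q) b = (B q b).map f) :
    Function.Semiconj (Prod.map (Exit.map f) id) B.step A.step := by
  rintro ⟨_ | _ | _, t⟩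
  · simp only [Auto.step, Prod.map, Exit.map, h]
    rfl
  · rfl
  · rfl

theorem Auto.iterate_step_map {σ τ : Type} {A : Auto σ} {B : Auto τ} {f : τ → σ}
    (h : ∀ q b, A (f q) b = (B q b).map f) (k : ℕ) (q : τ) (t : TapeState) :
    A.step^[k] (.goto (f q), t) =
      Prod.map (Exit.map f) id (B.step^[k] (.goto q, t)) :=
  ((semiconj_step h).iterate_right k (.goto q, t)).symm

theorem Auto.iterate_step_eq_halt_iff {σ τ : Type} {A : Auto σ} {B : Auto τ} {f : τ → σ}
    (h : ∀ q b, A (f q) b = (B q b).map f) {k : ℕ} {q : τ} {t t' : TapeState} :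
    A.step^[k] (.goto (f q), t) = (.halt, t') ↔ B.step^[k] (.goto q, t) = (.halt, t') := by
  rw [iterate_step_map h]
  rcases B.step^[k] (.goto q, t) with ⟨_ | _ | _, t''⟩ <;> simp [Exit.map]

/-! ## Instruction sequences that implement automata -/

/-- The position, within a block, of the part that deals with a given symbol. -/
def offset : Sym → ℕ
  | some false => 0
  | some true => 4
  | none => 8

namespace InSeq

namespace Advances

variable {Φ : Type} [DecidableEq Φ] {s : InSeq Φ} {p : ℕ} {f : Φ} {u : Family Φ} {t : TapeState}

theorem test {b : Sym} (h : s.get p = some (.ntst (.test f b))) (hu : u f = .operative t) :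
    s.Advances 1 p u (if t.cells t.head = b then p + 2 else p + 1) u := by
  have hadv := ntst h hu
  rw [TapeState.exec_test, Function.update_eq_self_iff.2 hu.symm] at hadv
  simpa only [BInstr.test, decide_eq_true_eq] using hadv

theorem set {y : Sym} {d : Dir} (h : s.get p = some (.plain (.set f y d)))
    (hu : u f = .operative t) :
    s.Advances 1 p u (p + 1) (Function.update u f (.operative (t.writeMove y d))) :=
  plain h hu

end Advances

/-- Execution of `s` from position `p` realizes the given exit, where state `q` is realized by the
block at position `12 q`. -/
def Realizes (s : InSeq ℕ) (p : ℕ) : Exit ℕ → Prop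
  | .goto q => ∀ n, s.extractApprox n p = s.extractApprox n (12 * q)
  | .halt => s.get p = some .halt
  | .dead => s.get p = some (.jmp 0)

/-- The instruction sequence `s` consists of blocks of twelve instructions, where the block at
position `12 q` implements the state `q` of `A`. -/
def Implements (s : InSeq ℕ) (A : Auto ℕ) : Prop :=
  ∀ q b, s.get (12 * q + offset b) = some (.ntst (.test 1 b)) ∧
    s.get (12 * q + offset b + 1) = some (.jmp 3) ∧
    s.get (12 * q + offset b + 2) = some (.plain (.set 1 (A q b).write (A q b).dir)) ∧
    s.Realizes (12 * q + offset b + 3) (A q b).exit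

namespace Implements

variable {s : InSeq ℕ} {A : Auto ℕ} {u : Family ℕ} {t : TapeState}

theorem advances_of_eq (hs : s.Implements A) (hu : u 1 = .operative t) (q : ℕ) {b : Sym}
    (hb : t.cells t.head = b) :
    s.Advances 2 (12 * q + offset b) u (12 * q + offset b + 3)
      (Function.update u 1 (.operative (t.writeMove (A q b).write (A q b).dir))) := by
  obtain ⟨htest, -, hset, -⟩ := hs q b
  have h := Advances.test htest hu
  rw [if_pos hb] at h
  exact h.trans (.set hset hu)

theorem advances_of_ne (hs : s.Implements A) (hu : u 1 = .operative t) (q : ℕ) {b : Sym}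
    (hb : t.cells t.head ≠ b) :
    s.Advances 1 (12 * q + offset b) u (12 * q + offset b + 4) u := by
  obtain ⟨htest, hjmp, -⟩ := hs q b
  have h := Advances.test htest hu
  rw [if_neg hb] at h
  exact h.congr_right (extractApprox_jmp_succ hjmp)

/-- The parts for the symbols `0`, `1` and `□` are tried in this order. -/
theorem exists_advances (hs : s.Implements A) (hu : u 1 = .operative t) (q : ℕ) :
    ∃ c, 1 ≤ c ∧ c ≤ 4 ∧
      s.Advances c (12 * q) u (12 * q + offset (t.cells t.head) + 3)
        (Function.update u 1 (.operative (t.writeMove (A q (t.cells t.head)).write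
          (A q (t.cells t.head)).dir))) := by
  have hne := fun b => hs.advances_of_ne hu q (b := b)
  have heq := hs.advances_of_eq hu q rfl
  rcases hb : t.cells t.head with _ | _ | _ <;> rw [hb] at heq
  · exact ⟨4, by omega, le_rfl, ((hne (some false) (by simp [hb])).trans
      (hne (some true) (by simp [hb]))).trans heq⟩
  · exact ⟨2, by omega, by omega, heq⟩
  · exact ⟨3, by omega, by omega, (hne (some false) (by simp [hb])).trans heq⟩

theorem exists_advances_step (hs : s.Implements A) (hu : u 1 = .operative t) {p : ℕ}
    {e : Exit ℕ} (hp : s.Realizes p e) :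
    ∃ c ≤ 4, (e = .halt ∨ e = .dead ∨ 1 ≤ c) ∧
      ∃ p', s.Advances c p u p' (Function.update u 1 (.operative (A.step (e, t)).2)) ∧
        s.Realizes p' (A.step (e, t)).1 := by
  have hself : Function.update u 1 (.operative t) = u := Function.update_eq_self_iff.2 hu.symm
  cases e with
  | goto q =>
    obtain ⟨c, hc, hc', hadv⟩ := hs.exists_advances hu q
    exact ⟨c, hc', .inr (.inr hc), _, fun n => by rw [hp]; exact hadv n, (hs q _).2.2.2⟩
  | halt => exact ⟨0, by omega, .inl rfl, p, by simpa [Auto.step, hself] using .refl s p u, hp⟩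
  | dead =>
    exact ⟨0, by omega, .inr (.inl rfl), p, by simpa [Auto.step, hself] using .refl s p u, hp⟩

theorem exists_advances_iterate (hs : s.Implements A) (hu : u 1 = .operative t) (k : ℕ) :
    ∃ c ≤ 4 * k,
      ((A.step^[k] (.goto 0, t)).1 = .halt ∨ (A.step^[k] (.goto 0, t)).1 = .dead ∨ k ≤ c) ∧
      ∃ p, s.Advances c 0 u p
          (Function.update u 1 (.operative (A.step^[k] (.goto 0, t)).2)) ∧
        s.Realizes p (A.step^[k] (.goto 0, t)).1 := by
  induction k with
  | zero =>
    refine ⟨0, le_rfl, .inr (.inr le_rfl), 0, ?_, fun _ => rfl⟩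
    simpa [← hu] using .refl s 0 u
  | succ k ih =>
    rw [Function.iterate_succ_apply']
    obtain ⟨c, hc, hkc, p, hadv, hp⟩ := ih
    generalize A.step^[k] (.goto 0, t) = x at hkc hadv hp ⊢
    obtain ⟨c', hc', hkc', p', hadv', hp'⟩ :=
      hs.exists_advances_step (Function.update_self 1 (.operative x.2) u) hp
    rw [Function.update_idem] at hadv'
    refine ⟨c' + c, by omega, ?_, p', hadv.trans hadv', hp'⟩
    obtain ⟨_ | _ | _, t'⟩ := x
    · simp only [reduceCtorEq, false_or] at hkc hkc'
      exact .inr (.inr (by omega))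
    · exact .inl rfl
    · exact .inr (.inl rfl)

end Implements

end InSeq

namespace Term

variable {p : Term ℕ} {A : Auto ℕ} {u : Family ℕ} {t t' : TapeState} {k : ℕ}

theorem apply_extract_of_implements (hp : p.seq.Implements A) (hu : u 1 = .operative t)
    (h : A.step^[k] (.goto 0, t) = (.halt, t')) :
    p.extract.apply u = Function.update u 1 (.operative t') := by
  obtain ⟨c, -, -, i, hadv, hi⟩ := hp.exists_advances_iterate hu k
  rw [h] at hadv hi
  exact apply_extract_of_halt hadv hi

theorem depth_extract_le_of_implements (hp : p.seq.Implements A) (hu : u 1 = .operative t)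
    (h : A.step^[k] (.goto 0, t) = (.halt, t')) : (p.extract.use u).depth ≤ (4 * k : ℕ) := by
  obtain ⟨c, hc, -, i, hadv, hi⟩ := hp.exists_advances_iterate hu k
  rw [h] at hi
  exact (depth_extract_le_of_halt hadv hi).trans (by exact_mod_cast hc)

theorem exists_iterate_step_eq_halt (hp : p.seq.Implements A) (hu : u 1 = .operative t)
    (hne : p.extract.apply u ≠ Family.empty) (hk : (p.extract.use u).depth < k) :
    ∃ t', A.step^[k] (.goto 0, t) = (.halt, t') := by
  obtain ⟨c, -, hhalt | hdead | hkc, i, hadv, hi⟩ := hp.exists_advances_iterate hu k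
  · exact ⟨_, Prod.ext hhalt rfl⟩
  · rw [hdead] at hi
    exact absurd (apply_extract_of_jmp_zero hadv hi) hne
  · exact absurd ((le_depth_extract hadv).trans_lt hk) (by simpa using hkc)

end Term

/-! ## Single-tape Turing-machine programs as finite automata -/

theorem Exit.map_map {σ τ υ : Type} (g : τ → υ) (f : σ → τ) (e : Exit σ) :
    (e.map f).map g = e.map (g ∘ f) := by
  cases e <;> rfl

theorem Rule.map_map {σ τ υ : Type} (g : τ → υ) (f : σ → τ) (r : Rule σ) :
    (r.map f).map g = r.map (g ∘ f) := by
  simp only [Rule.map, Exit.map_map]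

theorem Rule.exists_map_eq {σ τ : Type} {f : σ → τ} {r : Rule τ}
    (h : ∀ q, r.exit = .goto q → q ∈ Set.range f) : ∃ r' : Rule σ, r'.map f = r := by
  obtain ⟨y, d, q | _ | _⟩ := r
  · obtain ⟨q', rfl⟩ := h q rfl
    exact ⟨⟨y, d, .goto q'⟩, rfl⟩
  · exact ⟨⟨y, d, .halt⟩, rfl⟩
  · exact ⟨⟨y, d, .dead⟩, rfl⟩

/-- The behaviour of one block of a program, where `goto j` stands for the start of the `j`-th
block after the next one. -/
abbrev BlockSpec : Type := Sym → Rule ℕ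

/-- The instruction that realizes an exit if the next block starts `c` instructions further on. -/
def exitInstr (c : ℕ) : Exit ℕ → PInstr ℕ
  | .goto j => .jmp (12 * j + c)
  | .halt => .halt
  | .dead => .jmp 0

theorem InSeq.realizes_of_get_eq_exitInstr {s : InSeq ℕ} {p q c : ℕ} {e : Exit ℕ}
    (hc : p + c = 12 * (q + 1)) (hpos : 0 < c) (h : s.get p = some (exitInstr c e)) :
    s.Realizes p (e.map (q + 1 + ·)) := by
  obtain ⟨c, rfl⟩ := Nat.exists_eq_add_one.2 hpos
  cases e with
  | goto j =>
    intro n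
    rw [InSeq.extractApprox_jmp_succ (l := 12 * j + c) h,
      show p + (12 * j + c + 1) = 12 * (q + 1 + j) by omega]
  | halt => exact h
  | dead => exact h

namespace BlockSpec

/-- The four instructions of a block that deal with a given symbol. -/
def part (E : BlockSpec) (b : Sym) : List (PInstr ℕ) :=
  [.ntst (.test 1 b), .jmp 3, .plain (.set 1 (E b).write (E b).dir),
    exitInstr (9 - offset b) (E b).exit]

/-- The twelve instructions of a block. -/
def code (E : BlockSpec) : List (PInstr ℕ) :=
  E.part (some false) ++ E.part (some true) ++ E.part none

/-- All relative jumps go less than `n` blocks beyond the next block. -/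
def Bounded (n : ℕ) (E : BlockSpec) : Prop :=
  ∀ b j, (E b).exit = .goto j → j < n

theorem length_code (E : BlockSpec) : E.code.length = 12 := rfl

theorem getElem?_code (E : BlockSpec) (b : Sym) {r : ℕ} (hr : r < 4) :
    E.code[offset b + r]? = (E.part b)[r]? := by
  rcases b with _ | _ | _ <;> interval_cases r <;> rfl

theorem fociIn_of_mem_code {E : BlockSpec} {u : PInstr ℕ} (hu : u ∈ E.code) :
    u.FociIn (Set.Icc 1 1) := by
  have hpart : ∀ b, ∀ u ∈ E.part b, u.FociIn (Set.Icc 1 1) := by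
    intro b u hu
    simp only [part, List.mem_cons, List.not_mem_nil, or_false] at hu
    rcases hu with rfl | rfl | rfl | rfl
    · exact ⟨le_rfl, le_rfl⟩
    · trivial
    · exact ⟨le_rfl, le_rfl⟩
    · cases (E b).exit <;> trivial
  simp only [code, List.mem_append] at hu
  rcases hu with (hu | hu) | hu <;> exact hpart _ u hu

end BlockSpec

theorem isExit_iff {n c : ℕ} {u : PInstr ℕ} :
    IsExit n c u ↔ ∃ e, (∀ j, e = .goto j → j < n) ∧ exitInstr c e = u := by
  constructor
  · rintro (⟨i, hi, rfl⟩ | rfl | rfl)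
    exacts [⟨.goto i, by simpa using hi, rfl⟩, ⟨.dead, by simp, rfl⟩, ⟨.halt, by simp, rfl⟩]
  · rintro ⟨j | _ | _, he, rfl⟩
    exacts [.inl ⟨j, he j rfl, rfl⟩, .inr (.inr rfl), .inr (.inl rfl)]

theorem isBlock_iff {n : ℕ} {l : List (PInstr ℕ)} :
    IsBlock n l ↔ ∃ E : BlockSpec, E.Bounded n ∧ E.code = l := by
  constructor
  · rintro ⟨b₀, b₁, b₂, d₀, d₁, d₂, u₀, u₁, u₂, h₀, h₁, h₂, rfl⟩
    obtain ⟨e₀, he₀, rfl⟩ := isExit_iff.1 h₀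
    obtain ⟨e₁, he₁, rfl⟩ := isExit_iff.1 h₁
    obtain ⟨e₂, he₂, rfl⟩ := isExit_iff.1 h₂
    refine ⟨fun
      | some false => ⟨b₀, d₀, e₀⟩
      | some true => ⟨b₁, d₁, e₁⟩
      | none => ⟨b₂, d₂, e₂⟩, ?_, rfl⟩
    rintro (_ | _ | _)
    exacts [he₂, he₀, he₁]
  · rintro ⟨E, hE, rfl⟩
    exact ⟨_, _, _, _, _, _, _, _, _, isExit_iff.2 ⟨_, hE _, rfl⟩, isExit_iff.2 ⟨_, hE _, rfl⟩,
      isExit_iff.2 ⟨_, hE _, rfl⟩, rfl⟩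

theorem getElem?_flatten_of_forall_length_eq {α : Type*} {k : ℕ} {L : List (List α)}
    (hL : ∀ l ∈ L, l.length = k) {i r : ℕ} (hi : i < L.length) (hr : r < k) :
    L.flatten[k * i + r]? = L[i][r]? := by
  induction L generalizing i with
  | nil => simp at hi
  | cons l L ih =>
    rw [List.forall_mem_cons] at hL
    cases i with
    | zero =>
      rw [List.flatten_cons, List.getElem?_append_left (by omega)]
      simp
    | succ i =>
      rw [List.flatten_cons, List.getElem?_append_right (by rw [hL.1, mul_add]; omega), hL.1,
        show k * (i + 1) + r - k = k * i + r by rw [mul_add]; omega,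
        ih hL.2 (by simpa using hi), List.getElem_cons_succ]

/-- The instructions of consecutive blocks. -/
def programCode {n : ℕ} (es : Fin n → BlockSpec) : List (PInstr ℕ) :=
  (List.ofFn fun i => (es i).code).flatten

theorem length_programCode {n : ℕ} (es : Fin n → BlockSpec) :
    (programCode es).length = 12 * n := by
  simp [programCode, List.length_flatten, List.map_ofFn, Function.comp_def,
    BlockSpec.length_code, mul_comm]

section

variable {n : ℕ} [NeZero n] (es : Fin n → BlockSpec)

theorem get_rep_programCode (q : ℕ) {r : ℕ} (hr : r < 12) :
    (InSeq.fin (programCode es)).rep.get (12 * q + r) = (es (Fin.ofNat n q)).code[r]? := by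
  have hmod : (12 * q + r) % (12 * n) = 12 * (q % n) + r := by
    rw [Nat.mod_mul, show (12 * q + r) % 12 = r by omega, show (12 * q + r) / 12 = q by omega,
      add_comm]
  have hqn : q % n < n := Nat.mod_lt _ (NeZero.pos n)
  have hcode : (programCode es)[12 * (q % n) + r]? = (es (Fin.ofNat n q)).code[r]? := by
    rw [programCode, getElem?_flatten_of_forall_length_eq
      (by simp [BlockSpec.length_code]) (by simpa using hqn) hr, List.getElem_ofFn]
    rfl
  rw [InSeq.rep, InSeq.get, length_programCode, hmod, List.getD_eq_getElem?_getD, hcode,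
    List.getElem?_eq_getElem (by simpa [BlockSpec.length_code] using hr), Option.getD_some]

/-- The automaton of the infinite repetition of the given blocks, with the positions of the
consecutive blocks as states. -/
def unroll : Auto ℕ := fun q b => (es (Fin.ofNat n q) b).map (q + 1 + ·)

/-- The automaton of the infinite repetition of the given blocks, with the blocks as states. -/
def cyclic : Auto (Fin n) := fun i b => (es i b).map fun j => Fin.ofNat n (i + 1 + j)

theorem cyclic_ofNat (q : ℕ) (b : Sym) :
    cyclic es (Fin.ofNat n q) b = (unroll es q b).map (Fin.ofNat n) := by
  simp only [cyclic, unroll, Rule.map_map]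
  congr 1
  ext j
  simp [Nat.add_mod]

theorem implements_unroll : (InSeq.fin (programCode es)).rep.Implements (unroll es) := by
  intro q b
  have ho : offset b ≤ 8 := by rcases b with _ | _ | _ <;> simp [offset]
  have hget : ∀ r < 4, (InSeq.fin (programCode es)).rep.get (12 * q + offset b + r) =
      ((es (Fin.ofNat n q)).part b)[r]? := fun r hr => by
    rw [add_assoc, get_rep_programCode es q (by omega), BlockSpec.getElem?_code _ b hr]
  refine ⟨hget 0 (by omega), hget 1 (by omega), hget 2 (by omega), ?_⟩
  exact InSeq.realizes_of_get_eq_exitInstr (by omega) (by omega) (hget 3 (by omega))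

end

theorem exists_bounded_cyclic_eq {n : ℕ} [NeZero n] (A : Auto (Fin n)) :
    ∃ es : Fin n → BlockSpec, (∀ i, (es i).Bounded n) ∧ cyclic es = A := by
  refine ⟨fun i b => (A i b).map fun j : Fin n => (j + (n - 1 - i)) % n, fun i b j hj => ?_, ?_⟩
  · simp only [Rule.map] at hj
    cases hexit : (A i b).exit <;> simp only [hexit, Exit.map, reduceCtorEq, Exit.goto.injEq] at hj
    exact hj ▸ Nat.mod_lt _ (NeZero.pos n)
  · have hround : ∀ i j : Fin n, Fin.ofNat n (i + 1 + (j + (n - 1 - i)) % n) = j := by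
      intro i j
      have hi := i.isLt
      ext
      rw [Fin.val_ofNat, Nat.add_mod_mod, show (i : ℕ) + 1 + (j + (n - 1 - i)) = j + n by omega,
        Nat.add_mod_right, Nat.mod_eq_of_lt j.isLt]
    ext1 i
    ext1 b
    simp only [cyclic, Rule.map_map, Function.comp_def, hround]
    rcases A i b with ⟨_, _, _ | _ | _⟩ <;> rfl

/-- Execution of `t` follows the automaton `A` started in the state `q₀`. -/
def Term.Executes {σ : Type} (t : Term ℕ) (A : Auto σ) (q₀ : σ) : Prop :=
  ∃ (B : Auto ℕ) (f : ℕ → σ), t.seq.Implements B ∧ f 0 = q₀ ∧ ∀ q b, A (f q) b = (B q b).map f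

theorem exists_executes_of_mem_TMPrograms {t : Term ℕ} (ht : t ∈ TMPrograms) :
    ∃ (σ : Type) (_ : Finite σ) (A : Auto σ) (q₀ : σ), t.Executes A q₀ := by
  obtain ⟨t', bs, rfl, hne, hbs, hseq⟩ := ht
  have : NeZero bs.length := ⟨by simpa using hne⟩
  choose es _ hes using fun i : Fin bs.length => isBlock_iff.1 (hbs _ (bs.get_mem i))
  have hcode : programCode es = bs.flatten := by
    rw [programCode, funext hes, List.ofFn_get]
  refine ⟨Fin bs.length, inferInstance, cyclic es, _, unroll es, Fin.ofNat _, ?_, rfl,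
    cyclic_ofNat es⟩
  rw [Term.seq, hseq, ← hcode]
  exact implements_unroll es

/-- The concatenation of a list of instructions. The value at the empty list, which no term
represents, is arbitrary. -/
def Term.ofList {Φ : Type} : List (PInstr Φ) → Term Φ
  | [] => .instr .halt
  | [u] => .instr u
  | u :: v :: l => .conc (.instr u) (Term.ofList (v :: l))

theorem Term.seq_ofList {Φ : Type} {l : List (PInstr Φ)} (hl : l ≠ []) :
    (Term.ofList l).seq = .fin l := by
  induction l with
  | nil => exact absurd rfl hl
  | cons u l ih =>
    cases l with
    | nil => rfl
    | cons v l => rw [Term.ofList, Term.seq, ih (by simp)]; rfl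

theorem Term.fociIn_ofList {Φ : Type} {S : Set Φ} {l : List (PInstr Φ)}
    (h : ∀ u ∈ l, u.FociIn S) : (Term.ofList l).FociIn S := by
  induction l with
  | nil => trivial
  | cons u l ih =>
    cases l with
    | nil => exact h u (by simp)
    | cons v l => exact ⟨h u (by simp), ih fun w hw => h w (by simp [hw])⟩

theorem exists_mem_TMPrograms_of_bounded {n : ℕ} [NeZero n] {es : Fin n → BlockSpec}
    (hes : ∀ i, (es i).Bounded n) :
    ∃ t ∈ TMPrograms, t.FociIn (Set.Icc 1 1) ∧ t.seq = (InSeq.fin (programCode es)).rep := by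
  have hne : programCode es ≠ [] := by
    rw [← List.length_pos_iff, length_programCode]
    exact Nat.mul_pos (by norm_num) (NeZero.pos n)
  refine ⟨.rep (.ofList (programCode es)), ⟨_, List.ofFn fun i => (es i).code, rfl,
    by simp [NeZero.ne n], fun l hl => ?_, Term.seq_ofList hne⟩,
    Term.fociIn_ofList fun u hu => ?_, by rw [Term.seq, Term.seq_ofList hne]⟩
  · obtain ⟨i, rfl⟩ := List.mem_ofFn.1 hl
    exact isBlock_iff.2 ⟨es i, by simpa using hes i, rfl⟩
  · obtain ⟨l, hl, hu⟩ := List.mem_flatten.1 hu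
    obtain ⟨i, rfl⟩ := List.mem_ofFn.1 hl
    exact BlockSpec.fociIn_of_mem_code hu

theorem exists_mem_TMPrograms_executes {σ : Type} {A : Auto σ} {q₀ : σ} {S : Set σ}
    (hS : S.Finite) (hq₀ : q₀ ∈ S) (hA : ∀ q ∈ S, ∀ b q', (A q b).exit = .goto q' → q' ∈ S) :
    ∃ t ∈ TMPrograms, t.FociIn (Set.Icc 1 1) ∧ t.Executes A q₀ := by
  have : Finite S := hS
  have : Nonempty S := ⟨⟨q₀, hq₀⟩⟩
  have : NeZero (Nat.card S) := ⟨Nat.card_pos.ne'⟩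
  let e : Fin (Nat.card S) ≃ S := (Finite.equivFin S).symm.setValue 0 ⟨q₀, hq₀⟩
  choose B hB using fun i b => Rule.exists_map_eq (f := fun i => (e i : σ))
    (r := A (e i) b) fun q hq =>
      ⟨e.symm ⟨q, hA _ (e i).2 b q hq⟩, congrArg Subtype.val (e.apply_symm_apply _)⟩
  obtain ⟨es, hes, rfl⟩ := exists_bounded_cyclic_eq B
  obtain ⟨t, ht, htfoci, hseq⟩ := exists_mem_TMPrograms_of_bounded hes
  refine ⟨t, ht, htfoci, unroll es, fun q => e (Fin.ofNat _ q), hseq ▸ implements_unroll es,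
    congrArg Subtype.val (Equiv.setValue_eq _ _ _), fun q b => ?_⟩
  rw [← hB, cyclic_ofNat, Rule.map_map]
  rfl

/-! ## Computing functions by automata -/

theorem compUpTo_single (s : ℕ → TapeState) (k f : ℕ) :
    Family.compUpTo (fun j => Family.single j (s j)) k f =
      if 1 ≤ f ∧ f ≤ k then .operative (s f) else .absent := by
  induction k with
  | zero => rw [if_neg (by omega)]; rfl
  | succ k ih =>
    rw [Family.compUpTo, Family.comp, ih]
    by_cases hf : f = k + 1
    · subst hf
      simp [Family.single]
    · rw [Family.single, Function.update_of_ne hf]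
      by_cases h : 1 ≤ f ∧ f ≤ k
      · rw [if_pos h, if_pos (by omega)]; rfl
      · rw [if_neg h, if_neg (by omega)]; rfl

theorem inputFamily_apply {k f : ℕ} (w : Fin 1 → List Bool) (hf : 1 ≤ f) (hfk : f ≤ k) :
    inputFamily k w f =
      .operative (TapeState.ofList (if f = 1 then (w 0).map some else [])) := by
  rw [inputFamily, compUpTo_single fun j => TapeState.ofList
    (if j = 1 then [none].intercalate (List.ofFn fun i => (w i).map some) else []),
    if_pos ⟨hf, hfk⟩]
  simp

theorem inputFamily_one (w : Fin 1 → List Bool) :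
    inputFamily 1 w = Family.single 1 (TapeState.ofList ((w 0).map some)) := by
  rw [inputFamily, Family.compUpTo, if_pos rfl, List.ofFn_succ, List.ofFn_zero,
    List.intercalate_singleton]
  rfl

theorem outputFamily_apply (s : ℕ → TapeState) {k : ℕ} (hk : 1 ≤ k) (t : TapeState) :
    (Family.compUpTo (fun j => Family.single j (s j)) (k - 1)).comp (Family.single k t) k =
      .operative t := by
  rw [Family.comp, compUpTo_single, if_neg (by omega)]
  simp [Family.single]

namespace Term.Executes

variable {σ : Type} {p : Term ℕ} {A : Auto σ} {q₀ : σ} {F : List Bool → Bool} {T : ℕ → ℕ}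

theorem iterate_step_of_computesInTime (hp : p.Executes A q₀)
    (h : ComputesInTime p (ofDecision F) T) (w : List Bool) :
    A.step^[T w.length + 1] (.goto q₀, TapeState.ofList (w.map some)) =
      (.halt, TapeState.ofList [some (F w)]) := by
  obtain ⟨k, hk, -, hcomp, -⟩ := h
  obtain ⟨B, f, hB, rfl, hf⟩ := hp
  obtain ⟨⟨s, happly⟩, hdepth⟩ := hcomp (fun _ => w) [F w] (by simp [ofDecision])
  have hin := inputFamily_apply (fun _ => w) le_rfl hk
  have hout := (congrFun happly k).trans (outputFamily_apply s hk _)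
  rw [Fin.sum_univ_one] at hdepth
  rw [if_pos rfl] at hin
  obtain ⟨t', ht'⟩ := exists_iterate_step_eq_halt hB hin
    (fun hempty => by simp [hempty, Family.empty] at hout)
    (hdepth.trans_lt (by exact_mod_cast Nat.lt_succ_self _))
  rw [apply_extract_of_implements hB hin ht'] at hout
  rw [Auto.iterate_step_eq_halt_iff hf, ht']
  rcases eq_or_ne k 1 with rfl | hk1
  · rw [Function.update_self, Entry.operative.injEq] at hout
    rw [hout]
    rfl
  · rw [Function.update_of_ne hk1, inputFamily_apply _ hk le_rfl, if_neg hk1,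
      Entry.operative.injEq] at hout
    simpa [TapeState.ofList] using congrArg (TapeState.cells · 0) hout

theorem computesInTime (hp : p.Executes A q₀) (hfoci : p.FociIn (Set.Icc 1 1))
    (h : ∀ w : List Bool, ∃ k ≤ T w.length,
      A.step^[k] (.goto q₀, TapeState.ofList (w.map some)) =
        (.halt, TapeState.ofList [some (F w)])) :
    ComputesInTime p (ofDecision F) fun n => 4 * T n := by
  obtain ⟨B, f, hB, rfl, hf⟩ := hp
  refine ⟨1, le_rfl, hfoci, fun w y hy => ?_, fun w hw => absurd trivial hw⟩
  obtain rfl : y = [F (w 0)] := by simpa [ofDecision] using hy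
  obtain ⟨k, hk, hhalt⟩ := h (w 0)
  rw [Auto.iterate_step_eq_halt_iff hf] at hhalt
  have hin : inputFamily 1 w 1 = .operative (TapeState.ofList ((w 0).map some)) := by
    rw [inputFamily_one, Family.single, Function.update_self]
  refine ⟨⟨fun _ => TapeState.ofList [], ?_⟩, ?_⟩
  · rw [apply_extract_of_implements hB hin hhalt, inputFamily_one, Family.single,
      Function.update_idem]
    rfl
  · rw [Fin.sum_univ_one]
    exact (depth_extract_le_of_implements hB hin hhalt).trans
      (by exact_mod_cast Nat.mul_le_mul_left 4 hk)

end Term.Executes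

/-! ## From programs to Turing machines -/

/-- The state of `Auto.toTuringMachine` that corresponds to an exit. An inactive automaton is
represented by a machine that has rejected. -/
def Exit.toState {σ : Type} : Exit σ → σ ⊕ Option Bool
  | goto q => .inl q
  | halt => .inr none
  | dead => .inr (some false)

section

variable {σ : Type} [Finite σ] (A : Auto σ) (q₀ : σ)

/-- The Turing machine that behaves like the automaton `A` and, after termination of `A`, accepts
or rejects according to the symbol under the head; it does the latter in the state
`Sum.inr none`. -/
def Auto.toTuringMachine : TuringMachine where
  Q := σ ⊕ Option Bool
  Γ := Sym
  finQ := inferInstance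
  finΓ := inferInstance
  bit := some
  blank := none
  bit_injective := Option.some_injective _
  bit_ne_blank := by simp
  start := .inl q₀
  accept := .inr (some true)
  reject := .inr (some false)
  accept_ne_reject := by simp
  δ := fun
    | .inl q, b => ((A q b).exit.toState, (A q b).write, (A q b).dir)
    | .inr _, b => (.inr (some (decide (b = some true))), b, .stay)

/-- The configuration of `A.toTuringMachine q₀` that corresponds to a configuration of `A`. -/
def Auto.toCfg (x : Exit σ × TapeState) : (A.toTuringMachine q₀).Cfg :=
  ⟨x.1.toState, x.2.cells, x.2.head⟩

theorem Auto.toTuringMachine_step (q : σ) (t : TapeState) :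
    (A.toTuringMachine q₀).step (A.toCfg q₀ (.goto q, t)) = A.toCfg q₀ (A.step (.goto q, t)) := by
  rw [TuringMachine.step, if_neg (by simp [toCfg, toTuringMachine, Exit.toState])]
  rfl

theorem Auto.exists_toTuringMachine_iterate (k : ℕ) (x : Exit σ × TapeState) :
    ∃ j ≤ k, (A.toTuringMachine q₀).step^[j] (A.toCfg q₀ x) = A.toCfg q₀ (A.step^[k] x) := by
  induction k with
  | zero => exact ⟨0, le_rfl, rfl⟩
  | succ k ih =>
    obtain ⟨j, hj, hx⟩ := ih
    rw [Function.iterate_succ_apply']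
    rcases hk : A.step^[k] x with ⟨q | _ | _, t⟩ <;> rw [hk] at hx
    · exact ⟨j + 1, by omega, by rw [Function.iterate_succ_apply', hx, toTuringMachine_step]⟩
    · exact ⟨j, by omega, hx⟩
    · exact ⟨j, by omega, hx⟩

variable {A q₀} in
theorem Auto.toTuringMachine_decidesInTime {F : List Bool → Bool} {T : ℕ → ℕ}
    (h : ∀ w, A.step^[T w.length] (.goto q₀, TapeState.ofList (w.map some)) =
      (.halt, TapeState.ofList [some (F w)])) :
    (A.toTuringMachine q₀).DecidesInTime F fun n => T n + 1 := by
  intro w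
  obtain ⟨j, hj, hx⟩ := A.exists_toTuringMachine_iterate q₀ (T w.length)
    (.goto q₀, TapeState.ofList (w.map some))
  refine ⟨j + 1, Nat.succ_le_succ hj, ?_⟩
  change (_^[j + 1] (A.toCfg q₀ (.goto q₀, TapeState.ofList (w.map some)))).state = _
  rw [Function.iterate_succ_apply', hx, h, TuringMachine.step,
    if_neg (by simp [toCfg, toTuringMachine, Exit.toState])]
  cases F w <;> rfl

end

theorem mem_ClassP_of_computesInTime {F : List Bool → Bool} {t : Term ℕ} (ht : t ∈ TMPrograms)
    {T : ℕ → ℕ} (hT : T ∈ poly) (h : ComputesInTime t (ofDecision F) T) : F ∈ ClassP := by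
  obtain ⟨σ, _, A, q₀, hA⟩ := exists_executes_of_mem_TMPrograms ht
  obtain ⟨p, hp⟩ := hT
  exact ⟨A.toTuringMachine q₀, fun n => T n + 1 + 1, ⟨p + 1 + 1, fun n => by simp [hp]⟩,
    Auto.toTuringMachine_decidesInTime (hA.iterate_step_of_computesInTime h)⟩

/-! ## Tapes as pairs of lists -/

/-- A tape given by the symbols to the left of the head, in reverse order, and those from the head
on. The head is on cell `left.length`, and the cells after `right` are blank. -/
structure Zipper (Γ : Type) : Type where
  left : List Γ
  right : List Γ

namespace Zipper

variable {Γ : Type}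

/-- The contents of the cells of the tape. -/
def cells (blank : Γ) (Z : Zipper Γ) : ℕ → Γ := fun i => (Z.left.reverse ++ Z.right).getD i blank

/-- The symbol under the head. -/
def read (blank : Γ) (Z : Zipper Γ) : Γ := Z.right.headD blank

/-- The result of writing `y` and moving the head by `d`. -/
def writeMove (Z : Zipper Γ) (y : Γ) : Dir → Zipper Γ
  | .left => ⟨Z.left.tail, Z.left.take 1 ++ y :: Z.right.tail⟩
  | .stay => ⟨Z.left, y :: Z.right.tail⟩
  | .right => ⟨y :: Z.left, Z.right.tail⟩

variable {blank : Γ}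

theorem cells_left_length (Z : Zipper Γ) : Z.cells blank Z.left.length = Z.read blank := by
  rcases Z with ⟨L, _ | ⟨x, R⟩⟩ <;> simp [cells, read]

theorem cells_append_replicate (L R : List Γ) (j : ℕ) :
    cells blank ⟨L, R ++ List.replicate j blank⟩ = cells blank ⟨L, R⟩ := by
  funext i
  simp only [cells, ← List.append_assoc]
  rcases lt_or_ge i (L.reverse ++ R).length with hi | hi
  · rw [List.getD_append _ _ _ _ hi]
  · rw [List.getD_append_right _ _ _ _ hi, List.getD_eq_default _ _ hi,
      List.getD_eq_getElem?_getD, List.getElem?_getD_replicate_default_eq]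

theorem update_cells (Z : Zipper Γ) (y : Γ) :
    Function.update (Z.cells blank) Z.left.length y = cells blank ⟨Z.left, y :: Z.right.tail⟩ := by
  obtain ⟨L, R⟩ := Z
  funext i
  rw [Function.update_apply]
  rcases lt_trichotomy i L.length with hi | rfl | hi
  · simp [cells, List.getD_eq_getElem?_getD, List.getElem?_append, hi, hi.ne]
  · simp [cells]
  · obtain ⟨j, rfl⟩ := Nat.exists_eq_add_of_lt hi
    cases R <;> simp [cells, List.getD_eq_getElem?_getD, List.getElem?_append, add_assoc]

theorem cells_writeMove (Z : Zipper Γ) (y : Γ) (d : Dir) :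
    (Z.writeMove y d).cells blank = Function.update (Z.cells blank) Z.left.length y := by
  rw [update_cells]
  funext i
  rcases Z with ⟨_ | ⟨x, L⟩, R⟩ <;> cases d <;> simp [cells, writeMove]

theorem length_left_writeMove (Z : Zipper Γ) (y : Γ) (d : Dir) :
    (Z.writeMove y d).left.length = d.move Z.left.length := by
  rcases Z with ⟨_ | ⟨x, L⟩, R⟩ <;> cases d <;> rfl

theorem length_writeMove_le (Z : Zipper Γ) (y : Γ) (d : Dir) :
    (Z.writeMove y d).left.length + (Z.writeMove y d).right.length ≤
      Z.left.length + Z.right.length + 1 := by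
  rcases Z with ⟨_ | ⟨x, L⟩, R⟩ <;> cases d <;> simp [writeMove] <;> omega

/-- The tape over `{0, 1, □}` that is given by a pair of lists. -/
def tape (Z : Zipper Sym) : TapeState where
  cells := Z.cells none
  head := Z.left.length
  finite := ⟨(Z.left.reverse ++ Z.right).length, fun k =>
    List.getD_eq_default _ _ (Nat.le_add_right _ k)⟩

theorem tape_writeMove (Z : Zipper Sym) (y : Sym) (d : Dir) :
    (Z.writeMove y d).tape = Z.tape.writeMove y d :=
  TapeState.ext (Z.cells_writeMove y d) (Z.length_left_writeMove y d)

theorem tape_append_replicate (L R : List Sym) (j : ℕ) :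
    tape ⟨L, R ++ List.replicate j none⟩ = tape ⟨L, R⟩ :=
  TapeState.ext (cells_append_replicate L R j) rfl

theorem tape_writeMove_stay (Z : Zipper Sym) : (Z.writeMove (Z.read none) .stay).tape = Z.tape := by
  rcases Z with ⟨L, _ | ⟨x, R⟩⟩
  · exact tape_append_replicate L [] 1
  · rfl

end Zipper

namespace TuringMachine

/-- The configuration of `M` with state `q` whose tape is given by `Z`. -/
def zipperCfg (M : TuringMachine) (q : M.Q) (Z : Zipper M.Γ) : M.Cfg :=
  ⟨q, Z.cells M.blank, Z.left.length⟩

theorem step_zipperCfg (M : TuringMachine) {q : M.Q} (hq : ¬(q = M.accept ∨ q = M.reject))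
    (Z : Zipper M.Γ) {q' : M.Q} {y : M.Γ} {d : Dir} (hδ : M.δ q (Z.read M.blank) = (q', y, d)) :
    M.step (M.zipperCfg q Z) = M.zipperCfg q' (Z.writeMove y d) := by
  rw [step, if_neg (by exact hq)]
  simp only [zipperCfg, Zipper.cells_left_length, hδ, Zipper.cells_writeMove,
    Zipper.length_left_writeMove]

end TuringMachine

/-! ## Runs of automata -/

/-- Within `k` steps `A` gets from exit `e` and tape `Z` to exit `e'` and tape `Z'`. -/
def Auto.Reaches {σ : Type} (A : Auto σ) (k : ℕ) (e : Exit σ) (Z : Zipper Sym) (e' : Exit σ)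
    (Z' : Zipper Sym) : Prop :=
  ∃ j ≤ k, A.step^[j] (e, Z.tape) = (e', Z'.tape)

namespace Auto.Reaches

variable {σ : Type} {A : Auto σ} {k k' : ℕ} {q : σ} {e e' e'' : Exit σ} {Z Z' Z'' : Zipper Sym}
  {y : Sym} {d : Dir}

theorem refl : A.Reaches 0 e Z e Z := ⟨0, le_rfl, rfl⟩

theorem trans (h : A.Reaches k e Z e' Z') (h' : A.Reaches k' e' Z' e'' Z'') :
    A.Reaches (k + k') e Z e'' Z'' := by
  obtain ⟨j, hj, hstep⟩ := h
  obtain ⟨j', hj', hstep'⟩ := h'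
  exact ⟨j' + j, by omega, by rw [Function.iterate_add_apply, hstep, hstep']⟩

theorem mono (h : A.Reaches k e Z e' Z') (hk : k ≤ k') : A.Reaches k' e Z e' Z' :=
  let ⟨j, hj, hstep⟩ := h
  ⟨j, hj.trans hk, hstep⟩

theorem congr_left (h : A.Reaches k e Z e' Z') (hZ : Z''.tape = Z.tape) :
    A.Reaches k e Z'' e' Z' := by
  rwa [Reaches, hZ]

theorem congr_right (h : A.Reaches k e Z e' Z') (hZ : Z''.tape = Z'.tape) :
    A.Reaches k e Z e' Z'' := by
  rwa [Reaches, hZ]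

theorem single (h : A q (Z.read none) = ⟨y, d, e⟩) :
    A.Reaches 1 (.goto q) Z e (Z.writeMove y d) := by
  have hread : Z.tape.cells Z.tape.head = Z.read none := Z.cells_left_length
  refine ⟨1, le_rfl, ?_⟩
  rw [Function.iterate_one, step, hread, h, Zipper.tape_writeMove]

theorem single_stay (h : A q (Z.read none) = ⟨Z.read none, .stay, e⟩) :
    A.Reaches 1 (.goto q) Z e Z :=
  (single h).congr_right Z.tape_writeMove_stay.symm

theorem head (h : A q (Z.read none) = ⟨y, d, e⟩) (h' : A.Reaches k e (Z.writeMove y d) e' Z') :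
    A.Reaches (k + 1) (.goto q) Z e' Z' := by
  rw [add_comm]
  exact (single h).trans h'

theorem scan_right (hA : ∀ x : Bool, A q (some x) = ⟨some x, .right, .goto q⟩) (l : List Bool)
    (L R : List Sym) :
    A.Reaches l.length (.goto q) ⟨L, l.map some ++ R⟩ (.goto q) ⟨(l.map some).reverse ++ L, R⟩ := by
  induction l generalizing L with
  | nil => exact .refl
  | cons x l ih =>
    refine .head (hA x) ?_
    simpa [Zipper.writeMove] using ih (some x :: L)

/-- The scan starts after a left move because only then there is a symbol to the right of it. -/
theorem scan_left (f : Bool → Sym) (hA : ∀ x : Bool, A q (some x) = ⟨f x, .left, .goto q⟩)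
    (l : List Bool) (L R : List Sym) (y : Sym) :
    A.Reaches l.length (.goto q) (Zipper.writeMove ⟨l.map some ++ none :: L, R⟩ y .left) (.goto q)
      ⟨L, none :: ((l.map f).reverse ++ y :: R.tail)⟩ := by
  induction l generalizing y R with
  | nil => exact .refl
  | cons x l ih =>
    refine .head (hA x) ?_
    simpa [Zipper.writeMove] using ih (some x :: y :: R.tail) (f x)

end Auto.Reaches

/-! ## Codes of symbols -/

/-- A coding of the symbols of an alphabet by non-empty bit strings of the same length. -/
structure Coding (Γ : Type) : Type where
  size : ℕ
  enc : Γ → List Bool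
  size_pos : 0 < size
  length_enc : ∀ g, (enc g).length = size
  enc_injective : Function.Injective enc

theorem nonempty_coding (Γ : Type) [Finite Γ] [Nonempty Γ] : Nonempty (Coding Γ) := by
  classical
  have := Fintype.ofFinite Γ
  -- The code of `g` is the characteristic vector of `{g}`.
  refine ⟨⟨Fintype.card Γ, fun g => Finset.univ.toList.map fun x => decide (x = g),
    Fintype.card_pos, fun g => by simp, fun g g' h => ?_⟩⟩
  simpa using List.map_inj_left.1 h g (by simp)

namespace Coding

variable {Γ : Type} (C : Coding Γ)

/-- The symbol whose code, read from right to left, is in the given cells. Cells that do not hold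
a code stand for the blank: the tape of the simulated machine may be longer than its encoding. -/
noncomputable def dec (blank : Γ) : List Sym → Γ :=
  Function.extend (fun g => ((C.enc g).map some).reverse) id fun _ => blank

/-- The code of a string. -/
def encode (ys : List Γ) : List Bool := ys.flatMap C.enc

/-- The cells to the left of the head, in reverse order, that encode `xs` and are preceded by
`n + 1` blanks: the blanks mark the left end. -/
def encodeLeft (n : ℕ) (xs : List Γ) : List Sym :=
  (C.encode xs.reverse).reverse.map some ++ List.replicate (n + 1) none

/-- The encoding of a tape that starts behind `n + 1` blanks. -/
def encodeTape (n : ℕ) (Z : Zipper Γ) : Zipper Sym :=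
  ⟨C.encodeLeft n Z.left, (C.encode Z.right).map some⟩

theorem dec_map_enc (blank g : Γ) : C.dec blank ((C.enc g).map some).reverse = g :=
  Function.Injective.extend_apply (List.reverse_injective.comp
    ((List.map_injective_iff.2 (Option.some_injective _)).comp C.enc_injective)) _ _ g

theorem dec_replicate (blank : Γ) : C.dec blank (List.replicate C.size none) = blank := by
  refine Function.extend_apply' _ _ _ ?_
  rintro ⟨g, hg⟩
  have hmem : (none : Sym) ∈ ((C.enc g).map some).reverse := by
    rw [hg]
    exact List.mem_replicate.2 ⟨C.size_pos.ne', rfl⟩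
  simp at hmem

theorem length_encode (ys : List Γ) : (C.encode ys).length = C.size * ys.length := by
  simp [encode, List.length_flatMap, C.length_enc, mul_comm]

theorem encode_cons (y : Γ) (ys : List Γ) : C.encode (y :: ys) = C.enc y ++ C.encode ys :=
  List.flatMap_cons

theorem encodeLeft_cons (n : ℕ) (x : Γ) (xs : List Γ) :
    C.encodeLeft n (x :: xs) = (C.enc x).reverse.map some ++ C.encodeLeft n xs := by
  simp [encodeLeft, encode]

theorem exists_reverse_enc_eq_cons (g : Γ) :
    ∃ b l, (C.enc g).reverse = b :: l ∧ l.length + 1 = C.size := by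
  obtain ⟨b, l, h⟩ : ∃ b l, (C.enc g).reverse = b :: l := List.exists_cons_of_ne_nil (by
    rw [← List.length_pos_iff, List.length_reverse, C.length_enc]
    exact C.size_pos)
  refine ⟨b, l, h, ?_⟩
  rw [← List.length_cons, ← h, List.length_reverse, C.length_enc]

theorem exists_tape_encodeTape_eq (blank : Γ) (n : ℕ) (Z : Zipper Γ) :
    ∃ (l : List Sym) (s : Sym), l.length + 1 = C.size ∧
      C.dec blank (s :: l.reverse) = Z.read blank ∧
      (C.encodeTape n Z).tape = Zipper.tape
        ⟨C.encodeLeft n Z.left, l ++ s :: (C.encode Z.right.tail).map some⟩ := by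
  rcases Z with ⟨L, _ | ⟨y, R⟩⟩
  · obtain ⟨m, hm⟩ := Nat.exists_eq_add_one.2 C.size_pos
    refine ⟨List.replicate m none, none, by simp [hm], ?_, ?_⟩
    · rw [List.reverse_replicate, ← List.replicate_succ, ← hm]
      exact C.dec_replicate blank
    · have := Zipper.tape_append_replicate (C.encodeLeft n L) [] (m + 1)
      rw [List.replicate_succ'] at this
      exact this.symm
  · obtain ⟨b, l, hb, hl⟩ := C.exists_reverse_enc_eq_cons y
    have hy : C.enc y = l.reverse ++ [b] := by rw [← List.reverse_reverse (C.enc y), hb]; simp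
    refine ⟨l.reverse.map some, some b, by simpa using hl, ?_, ?_⟩
    · have := C.dec_map_enc blank y
      rw [hy] at this
      simpa [Zipper.read] using this
    · simp [encodeTape, encode_cons, hy]

end Coding

/-! ## The simulating automaton -/

/-- The states of the simulating automaton. The input is converted bit by bit: a bit is erased
(`load`), carried past the rest of the input and past the codes that are there already
(`carry`, `carryOn`), and its code is appended to the latter (`append`); then the head returns
(`back`, `backOn`). A simulated step reads a code (`readCode`), replaces it from right to left
(`writeCode`), and moves to another code (`moveRight`, `moveLeft`). In the end the head moves to
the end of the codes (`seekEnd`), these are erased (`erase`), and the first cell is searched: it is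
reached if a bit that has been written before a left move (`probe`) is still under the head after
the move (`check`); otherwise that bit is removed (`restore`). -/
inductive SimState (Q : Type) : Type
  | load
  | carry (b : Bool)
  | carryOn (b : Bool)
  | append (l : List Bool)
  | back
  | backOn
  | readCode (q : Q) (l : List Sym)
  | writeCode (q : Q) (d : Dir) (l : List Bool)
  | moveRight (q : Q) (j : ℕ)
  | moveLeft (q : Q) (j : ℕ)
  | seekEnd (v : Bool)
  | erase (v : Bool)
  | probe (v : Bool)
  | check (v : Bool)
  | restore (v : Bool)

/-- The states whose list and counter do not exceed the length `n` of a code. -/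
def SimState.Bounded (n : ℕ) {Q : Type} : SimState Q → Prop
  | append l => l.length ≤ n
  | readCode _ l => l.length < n
  | writeCode _ _ l => l.length ≤ n
  | moveRight _ j => j ≤ n
  | moveLeft _ j => j ≤ n
  | _ => True

instance : Finite Dir :=
  Finite.of_injective (fun | .left => (0 : Fin 3) | .stay => 1 | .right => 2) (by
    rintro (_ | _ | _) (_ | _ | _) <;> simp)

theorem SimState.finite_setOf_bounded (n : ℕ) (Q : Type) [Finite Q] :
    {s : SimState Q | s.Bounded n}.Finite := by
  have hB : (Set.univ : Set Bool).Finite := Set.finite_univ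
  have hQ : (Set.univ : Set Q).Finite := Set.finite_univ
  have hj : {j : ℕ | j ≤ n}.Finite := Set.finite_le_nat n
  have hl (α : Type) [Finite α] : {l : List α | l.length ≤ n}.Finite := List.finite_length_le α n
  refine Set.Finite.subset
    ((((((((((((Set.toFinite {load, back, backOn}).union (hB.image carry)).union
      (hB.image carryOn)).union ((hl Bool).image append)).union
      (hQ.image2 readCode (hl Sym))).union
      ((Set.finite_univ (α := Q × Dir)).image2 (fun p l => writeCode p.1 p.2 l) (hl Bool))).union
      (hQ.image2 moveRight hj)).union (hQ.image2 moveLeft hj)).union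
      (hB.image seekEnd)).union (hB.image erase)).union (hB.image probe)).union
      ((hB.image check).union (hB.image restore))) fun s hs => ?_
  cases s <;> simp_all [SimState.Bounded, le_of_lt]

section

open SimState

variable (M : TuringMachine) (C : Coding M.Γ)

open Classical in
/-- The state in which the simulation of `M` from state `q` starts. -/
noncomputable def enter (q : M.Q) : SimState M.Q :=
  if q = M.accept then seekEnd true else if q = M.reject then seekEnd false else readCode q []

theorem enter_verdict (v : Bool) : enter M (if v then M.accept else M.reject) = seekEnd v := by
  cases v with
  | false => simp [enter, M.accept_ne_reject.symm]
  | true => simp [enter]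

theorem enter_of_not_halted {q : M.Q} (hq : ¬(q = M.accept ∨ q = M.reject)) :
    enter M q = readCode q [] := by
  rw [not_or] at hq
  rw [enter, if_neg hq.1, if_neg hq.2]

/-- The automaton that simulates `M`. -/
noncomputable def simAuto : Auto (SimState M.Q)
  | load, some b => ⟨none, .right, .goto (carry b)⟩
  | load, none => ⟨none, .right, .goto (enter M M.start)⟩
  | carry b, some x => ⟨some x, .right, .goto (carry b)⟩
  | carry b, none => ⟨none, .right, .goto (carryOn b)⟩
  | carryOn b, some x => ⟨some x, .right, .goto (carryOn b)⟩
  | carryOn b, none => ⟨none, .stay, .goto (append (C.enc (M.bit b)))⟩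
  | append (x :: l), _ => ⟨some x, .right, .goto (append l)⟩
  | append [], s => ⟨s, .left, .goto back⟩
  | back, some x => ⟨some x, .left, .goto back⟩
  | back, none => ⟨none, .left, .goto backOn⟩
  | backOn, some x => ⟨some x, .left, .goto backOn⟩
  | backOn, none => ⟨none, .right, .goto load⟩
  | readCode q l, s =>
    if l.length + 1 = C.size then
      ⟨s, .stay, .goto (writeCode (M.δ q (C.dec M.blank (s :: l))).1
        (M.δ q (C.dec M.blank (s :: l))).2.2
        (C.enc (M.δ q (C.dec M.blank (s :: l))).2.1).reverse)⟩
    else ⟨s, .right, .goto (readCode q (s :: l))⟩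
  | writeCode q d (x :: l), _ => ⟨some x, .left, .goto (writeCode q d l)⟩
  | writeCode q .stay [], s => ⟨s, .right, .goto (enter M q)⟩
  | writeCode q .right [], s => ⟨s, .right, .goto (moveRight q C.size)⟩
  | writeCode q .left [], none => ⟨none, .right, .goto (enter M q)⟩
  | writeCode q .left [], some x => ⟨some x, .stay, .goto (moveLeft q (C.size - 1))⟩
  | moveRight q (j + 1), s => ⟨s, .right, .goto (moveRight q j)⟩
  | moveRight q 0, s => ⟨s, .stay, .goto (enter M q)⟩
  | moveLeft q (j + 1), s => ⟨s, .left, .goto (moveLeft q j)⟩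
  | moveLeft q 0, s => ⟨s, .stay, .goto (enter M q)⟩
  | seekEnd v, some x => ⟨some x, .right, .goto (seekEnd v)⟩
  | seekEnd v, none => ⟨none, .left, .goto (erase v)⟩
  | erase v, some _ => ⟨none, .left, .goto (erase v)⟩
  | erase v, none => ⟨none, .stay, .goto (probe v)⟩
  | probe v, _ => ⟨some true, .left, .goto (check v)⟩
  | check v, some _ => ⟨some v, .stay, .halt⟩
  | check v, none => ⟨none, .right, .goto (restore v)⟩
  | restore v, _ => ⟨none, .left, .goto (probe v)⟩

theorem bounded_enter (q : M.Q) : (enter M q).Bounded C.size := by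
  rw [enter]
  split_ifs
  · trivial
  · trivial
  · exact C.size_pos

theorem bounded_of_simAuto_eq_goto {s : SimState M.Q} (hs : s.Bounded C.size) (b : Sym)
    (s' : SimState M.Q) (h : (simAuto M C s b).exit = .goto s') : s'.Bounded C.size := by
  have henter := bounded_enter M C
  have hpos := C.size_pos
  unfold simAuto at h
  split at h <;> first
    | (cases h; done)
    | (cases h; exact henter _)
    | (cases h; simp_all [SimState.Bounded, C.length_enc]; done)
    | (cases h; simp_all [SimState.Bounded]; omega)
    | (split_ifs at h <;> cases h <;> simp_all [SimState.Bounded, C.length_enc]; omega)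

end

section

open SimState Auto

variable {M : TuringMachine} {C : Coding M.Γ}

/-! ## Conversion of the input -/

theorem reaches_append_of_load (b : Bool) (w E : List Bool) (L : List Sym) :
    (simAuto M C).Reaches (w.length + E.length + 3) (.goto load)
      ⟨L, some b :: (w.map some ++ none :: E.map some)⟩ (.goto (append (C.enc (M.bit b))))
      ⟨(E.map some).reverse ++ none :: ((w.map some).reverse ++ none :: L), []⟩ := by
  have hcarry : (simAuto M C).Reaches (w.length + 1) (.goto load)
      ⟨L, some b :: (w.map some ++ none :: E.map some)⟩ (.goto (carry b))
      ⟨(w.map some).reverse ++ none :: L, none :: E.map some⟩ :=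
    .head rfl (.scan_right (fun _ => rfl) w (none :: L) (none :: E.map some))
  have hcarryOn : (simAuto M C).Reaches (E.length + 1) (.goto (carry b))
      ⟨(w.map some).reverse ++ none :: L, none :: E.map some⟩ (.goto (carryOn b))
      ⟨(E.map some).reverse ++ none :: ((w.map some).reverse ++ none :: L), []⟩ := by
    have hscan := Reaches.scan_right (A := simAuto M C) (q := carryOn b) (fun _ => rfl) E
      (none :: ((w.map some).reverse ++ none :: L)) []
    rw [List.append_nil] at hscan
    exact .head rfl hscan
  exact ((hcarry.trans hcarryOn).trans (.single_stay rfl)).mono (by omega)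

theorem reaches_append_nil (l : List Bool) (L : List Sym) :
    (simAuto M C).Reaches l.length (.goto (append l)) ⟨L, []⟩ (.goto (append []))
      ⟨(l.map some).reverse ++ L, []⟩ := by
  induction l generalizing L with
  | nil => exact .refl
  | cons x l ih =>
    refine .head (y := some x) (d := .right) rfl ?_
    simpa [Zipper.writeMove] using ih (some x :: L)

theorem reaches_load_of_append_nil (w E : List Bool) (L : List Sym) :
    (simAuto M C).Reaches (w.length + E.length + 3) (.goto (append []))
      ⟨(E.map some).reverse ++ none :: ((w.map some).reverse ++ none :: L), []⟩ (.goto load)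
      ⟨none :: L, w.map some ++ none :: E.map some⟩ := by
  have hback : (simAuto M C).Reaches (E.length + 1) (.goto (append []))
      ⟨(E.map some).reverse ++ none :: ((w.map some).reverse ++ none :: L), []⟩ (.goto back)
      ⟨(w.map some).reverse ++ none :: L, none :: E.map some⟩ := by
    have hscan := Reaches.scan_left (A := simAuto M C) (q := back) some (fun _ => rfl) E.reverse
      ((w.map some).reverse ++ none :: L) [] none
    simp only [List.length_reverse, List.map_reverse, List.reverse_reverse] at hscan
    exact (Reaches.head rfl hscan).congr_right
      (Zipper.tape_append_replicate _ (none :: E.map some) 1).symm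
  have hbackOn : (simAuto M C).Reaches (w.length + 1) (.goto back)
      ⟨(w.map some).reverse ++ none :: L, none :: E.map some⟩ (.goto backOn)
      ⟨L, none :: (w.map some ++ none :: E.map some)⟩ := by
    have hscan := Reaches.scan_left (A := simAuto M C) (q := backOn) some (fun _ => rfl) w.reverse
      L (none :: E.map some) none
    simp only [List.length_reverse, List.map_reverse, List.reverse_reverse] at hscan
    exact .head rfl hscan
  exact ((hback.trans hbackOn).trans (.single (d := .right) rfl)).mono (by omega)

theorem reaches_load_of_load (b : Bool) (w E : List Bool) (L : List Sym) :
    (simAuto M C).Reaches (2 * w.length + 2 * E.length + 2 * C.size + 6) (.goto load)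
      ⟨L, some b :: (w.map some ++ none :: E.map some)⟩ (.goto load)
      ⟨none :: L, w.map some ++ none :: (E ++ C.enc (M.bit b)).map some⟩ := by
  have happend := reaches_append_nil (M := M) (C := C) (C.enc (M.bit b))
    ((E.map some).reverse ++ none :: ((w.map some).reverse ++ none :: L))
  rw [← List.append_assoc, ← List.reverse_append, ← List.map_append] at happend
  refine (((reaches_append_of_load b w E L).trans happend).trans
    (reaches_load_of_append_nil w (E ++ C.enc (M.bit b)) L)).mono ?_
  rw [List.length_append, C.length_enc]
  omega

theorem reaches_enter_of_load {P i : ℕ} {w E : List Bool}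
    (hP : 2 * w.length + 2 * (E.length + C.size * w.length) + 6 ≤ P) :
    (simAuto M C).Reaches (w.length * P + 1) (.goto load)
      ⟨List.replicate i none, w.map some ++ none :: E.map some⟩ (.goto (enter M M.start))
      ⟨List.replicate (i + w.length + 1) none, (E ++ C.encode (w.map M.bit)).map some⟩ := by
  induction w generalizing i E with
  | nil =>
    simpa [Zipper.writeMove, Coding.encode, List.replicate_succ] using
      Reaches.single (A := simAuto M C) (q := load)
        (Z := ⟨List.replicate i none, none :: E.map some⟩) (d := .right) rfl
  | cons b w ih =>
    rw [List.length_cons, mul_add_one C.size] at hP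
    have hbit := reaches_load_of_load (C := C) b w E (List.replicate i none)
    have hrest := ih (i := i + 1) (E := E ++ C.enc (M.bit b)) (by
      rw [List.length_append, C.length_enc]
      omega)
    rw [List.append_assoc, ← C.encode_cons, add_right_comm i 1, add_assoc i] at hrest
    refine (hbit.trans hrest).mono ?_
    rw [List.length_cons, Nat.add_one_mul w.length P]
    omega

/-! ## Simulation of a step -/

theorem reaches_writeCode_of_readCode (l acc : List Sym) (s : Sym) (L R : List Sym)
    (hl : acc.length + l.length + 1 = C.size) {q q' : M.Q} {y : M.Γ} {d : Dir}
    (hδ : M.δ q (C.dec M.blank (s :: (l.reverse ++ acc))) = (q', y, d)) :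
    (simAuto M C).Reaches (l.length + 1) (.goto (readCode q acc)) ⟨L, l ++ s :: R⟩
      (.goto (writeCode q' d (C.enc y).reverse)) ⟨l.reverse ++ L, s :: R⟩ := by
  induction l generalizing acc L with
  | nil =>
    refine .single_stay ?_
    rw [List.length_nil, add_zero] at hl
    rw [List.reverse_nil, List.nil_append] at hδ
    simp [simAuto, hl, hδ, Zipper.read]
  | cons z l ih =>
    rw [List.length_cons] at hl
    refine .head (y := z) (d := .right) (e := .goto (readCode q (z :: acc))) ?_ ?_
    · rw [simAuto, if_neg (by omega)]
      rfl
    · simpa [Zipper.writeMove] using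
        ih (z :: acc) (z :: L) (by rw [List.length_cons]; omega) (by simpa using hδ)

theorem reaches_writeCode_nil (q : M.Q) (d : Dir) (p : List Bool) (l : List Sym) (b : Bool)
    (s a : Sym) (L R : List Sym) (hl : l.length = p.length) :
    (simAuto M C).Reaches (p.length + 1) (.goto (writeCode q d (b :: p))) ⟨l ++ a :: L, s :: R⟩
      (.goto (writeCode q d [])) ⟨L, a :: ((b :: p).reverse.map some ++ R)⟩ := by
  induction p generalizing l b s R with
  | nil =>
    obtain rfl := List.length_eq_zero_iff.1 hl
    exact .single (y := some b) (d := .left) rfl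
  | cons c p ih =>
    obtain ⟨z, l, rfl⟩ := List.exists_cons_of_length_eq_add_one hl
    refine .head (y := some b) (d := .left) rfl ?_
    simpa [Zipper.writeMove] using ih l c z (some b :: R) (by simpa using hl)

theorem reaches_enter_of_moveRight (q : M.Q) (l L R : List Sym) :
    (simAuto M C).Reaches (l.length + 1) (.goto (moveRight q l.length)) ⟨L, l ++ R⟩
      (.goto (enter M q)) ⟨l.reverse ++ L, R⟩ := by
  induction l generalizing L with
  | nil => exact .single_stay rfl
  | cons x l ih =>
    refine .head (y := x) (d := .right) rfl ?_
    simpa [Zipper.writeMove] using ih (x :: L)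

theorem reaches_enter_of_moveLeft (q : M.Q) (l L R : List Sym) (s : Sym) :
    (simAuto M C).Reaches (l.length + 1) (.goto (moveLeft q l.length)) ⟨l ++ L, s :: R⟩
      (.goto (enter M q)) ⟨L, l.reverse ++ s :: R⟩ := by
  induction l generalizing s R with
  | nil => exact .single_stay rfl
  | cons x l ih =>
    refine .head (y := s) (d := .left) rfl ?_
    simpa [Zipper.writeMove] using ih (s :: R) x

theorem reaches_enter_of_writeCode_left (q : M.Q) (n : ℕ) (xs ys : List M.Γ) {a : Sym}
    {L : List Sym} (hL : C.encodeLeft n xs = a :: L) :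
    (simAuto M C).Reaches (C.size + 1) (.goto (writeCode q .left []))
      ⟨L, a :: (C.encode ys).map some⟩ (.goto (enter M q))
      (C.encodeTape n ⟨xs.tail, xs.take 1 ++ ys⟩) := by
  cases xs with
  | nil =>
    obtain ⟨rfl, rfl⟩ : none = a ∧ List.replicate n none = L := by
      simpa [Coding.encodeLeft, Coding.encode, List.replicate_succ] using hL
    exact (Reaches.single (d := .right) rfl).mono (by omega)
  | cons x xs =>
    obtain ⟨b, r, hbr, hr⟩ := C.exists_reverse_enc_eq_cons x
    have hx : C.enc x = r.reverse ++ [b] := by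
      rw [← List.reverse_reverse (C.enc x), hbr, List.reverse_cons]
    obtain ⟨rfl, rfl⟩ : some b = a ∧ r.map some ++ C.encodeLeft n xs = L := by
      simpa [C.encodeLeft_cons, hbr] using hL
    have hmove := reaches_enter_of_moveLeft (C := C) q (r.map some) (C.encodeLeft n xs)
      ((C.encode ys).map some) (some b)
    rw [List.length_map, Nat.eq_sub_of_add_eq hr] at hmove
    refine (Reaches.head (y := some b) (d := .stay) rfl ?_).mono
      (show C.size - 1 + 1 + 1 ≤ _ by omega)
    simpa [Zipper.writeMove, Coding.encodeTape, C.encode_cons, hx] using hmove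

theorem reaches_enter_of_writeCode_nil (q : M.Q) (d : Dir) (n : ℕ) (Z : Zipper M.Γ) (y : M.Γ)
    {a : Sym} {L : List Sym} (hL : C.encodeLeft n Z.left = a :: L) :
    (simAuto M C).Reaches (C.size + 2) (.goto (writeCode q d []))
      ⟨L, a :: (C.encode (y :: Z.right.tail)).map some⟩ (.goto (enter M q))
      (C.encodeTape n (Z.writeMove y d)) := by
  cases d with
  | left =>
    exact (reaches_enter_of_writeCode_left q n Z.left (y :: Z.right.tail) hL).mono (by omega)
  | stay =>
    rw [Zipper.writeMove, Coding.encodeTape, hL]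
    exact (Reaches.single (d := .right) rfl).mono (by omega)
  | right =>
    refine .head (y := a) (d := .right) rfl ?_
    have hmove := reaches_enter_of_moveRight (C := C) q ((C.enc y).map some) (a :: L)
      ((C.encode Z.right.tail).map some)
    rw [List.length_map, C.length_enc] at hmove
    simpa [Zipper.writeMove, Coding.encodeTape, C.encode_cons, C.encodeLeft_cons, ← hL] using hmove

theorem reaches_enter_of_step {q q' : M.Q} (hq : ¬(q = M.accept ∨ q = M.reject)) (n : ℕ)
    (Z : Zipper M.Γ) {y : M.Γ} {d : Dir} (hδ : M.δ q (Z.read M.blank) = (q', y, d)) :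
    (simAuto M C).Reaches (3 * C.size + 2) (.goto (enter M q)) (C.encodeTape n Z)
      (.goto (enter M q')) (C.encodeTape n (Z.writeMove y d)) := by
  obtain ⟨l, s, hl, hdec, htape⟩ := C.exists_tape_encodeTape_eq M.blank n Z
  obtain ⟨a, L, hL⟩ : ∃ a L, C.encodeLeft n Z.left = a :: L :=
    List.exists_cons_of_ne_nil (by simp [Coding.encodeLeft])
  obtain ⟨b, p, hbp, hp⟩ := C.exists_reverse_enc_eq_cons y
  have hdecode : M.δ q (C.dec M.blank (s :: (l.reverse ++ []))) = (q', y, d) := by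
    rw [List.append_nil, hdec, hδ]
  have hread := reaches_writeCode_of_readCode (C := C) l [] s (C.encodeLeft n Z.left)
    ((C.encode Z.right.tail).map some) (by rw [List.length_nil, zero_add, hl]) hdecode
  have hwrite := reaches_writeCode_nil (C := C) q' d p l.reverse b s a L
    ((C.encode Z.right.tail).map some) (by rw [List.length_reverse]; omega)
  have hmove := reaches_enter_of_writeCode_nil (C := C) q' d n Z y hL
  rw [hbp, hL] at hread
  rw [← hbp, List.reverse_reverse, ← List.map_append, ← C.encode_cons, hbp] at hwrite
  rw [enter_of_not_halted M hq]
  refine Reaches.congr_left ?_ htape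
  rw [hL]
  exact ((hread.trans hwrite).trans hmove).mono (by omega)

theorem exists_reaches_seekEnd (n m : ℕ) (q : M.Q) (Z : Zipper M.Γ) (v : Bool)
    (h : (M.step^[m] (M.zipperCfg q Z)).state = if v then M.accept else M.reject) :
    ∃ Z' : Zipper M.Γ, Z'.left.length + Z'.right.length ≤ Z.left.length + Z.right.length + m ∧
      (simAuto M C).Reaches (m * (3 * C.size + 2)) (.goto (enter M q)) (C.encodeTape n Z)
        (.goto (seekEnd v)) (C.encodeTape n Z') := by
  induction m generalizing q Z with
  | zero =>
    refine ⟨Z, le_rfl, ?_⟩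
    obtain rfl : q = _ := h
    rw [enter_verdict, zero_mul]
    exact .refl
  | succ m ih =>
    rw [Function.iterate_succ_apply] at h
    by_cases hq : q = M.accept ∨ q = M.reject
    · rw [TuringMachine.step, if_pos (by exact hq)] at h
      obtain ⟨Z', hlen, hrun⟩ := ih q Z h
      exact ⟨Z', by omega, hrun.mono (Nat.mul_le_mul_right _ (by omega))⟩
    · obtain ⟨q', y, d, hδ⟩ : ∃ q' y d, M.δ q (Z.read M.blank) = (q', y, d) := ⟨_, _, _, rfl⟩
      rw [M.step_zipperCfg hq Z hδ] at h
      obtain ⟨Z', hlen, hrun⟩ := ih _ _ h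
      refine ⟨Z', ?_, ((reaches_enter_of_step hq n Z hδ).trans hrun).mono ?_⟩
      · have := Z.length_writeMove_le y d
        omega
      · rw [add_one_mul, add_comm]

/-! ## Output of the verdict -/

theorem reaches_probe_of_seekEnd (v : Bool) (n : ℕ) (Z : Zipper M.Γ) :
    (simAuto M C).Reaches (2 * (C.size * (Z.left.length + Z.right.length)) + 2)
      (.goto (seekEnd v)) (C.encodeTape n Z) (.goto (probe v)) ⟨List.replicate n none, [none]⟩ := by
  set B := (C.encode (Z.left.reverse ++ Z.right)).reverse with hB
  have hlen : B.length = C.size * (Z.left.length + Z.right.length) := by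
    rw [hB, List.length_reverse, C.length_encode, List.length_append, List.length_reverse]
  have hseek : (simAuto M C).Reaches (C.encode Z.right).length (.goto (seekEnd v))
      (C.encodeTape n Z) (.goto (seekEnd v)) ⟨B.map some ++ none :: List.replicate n none, []⟩ := by
    simpa [hB, Coding.encodeTape, Coding.encodeLeft, Coding.encode, List.replicate_succ] using
      Reaches.scan_right (A := simAuto M C) (q := seekEnd v) (fun _ => rfl) (C.encode Z.right)
        (C.encodeLeft n Z.left) []
  have herase : (simAuto M C).Reaches (B.length + 1) (.goto (seekEnd v))
      ⟨B.map some ++ none :: List.replicate n none, []⟩ (.goto (erase v))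
      ⟨List.replicate n none, [none] ++ List.replicate (B.length + 1) none⟩ := by
    have hscan := Reaches.scan_left (A := simAuto M C) (q := erase v) (fun _ => none)
      (fun _ => rfl) B (List.replicate n none) [] none
    refine .head (y := none) (d := .left) rfl ?_
    simpa [List.replicate_succ'] using hscan
  refine (((hseek.trans herase).trans (.single_stay rfl)).mono ?_).congr_right
    (Zipper.tape_append_replicate _ _ _).symm
  have : (C.encode Z.right).length ≤ B.length := by
    rw [hlen, C.length_encode]
    exact Nat.mul_le_mul_left _ (Nat.le_add_left _ _)
  omega

theorem reaches_probe_left_end (v : Bool) (n : ℕ) :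
    (simAuto M C).Reaches (3 * n) (.goto (probe v)) ⟨List.replicate n none, [none]⟩
      (.goto (probe v)) ⟨[], [none]⟩ := by
  induction n with
  | zero => exact .refl
  | succ n ih =>
    refine .head (y := some true) (d := .left) rfl ?_
    refine .head (y := none) (d := .right) rfl ?_
    refine .head (y := none) (d := .left) rfl ?_
    exact ih.congr_left (Zipper.tape_append_replicate _ [none] 1)

theorem reaches_halt_of_probe (v : Bool) (n : ℕ) :
    (simAuto M C).Reaches (3 * n + 2) (.goto (probe v)) ⟨List.replicate n none, [none]⟩ .halt
      ⟨[], [some v]⟩ := by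
  refine (reaches_probe_left_end v n).trans (k' := 2) ?_
  exact .head (y := some true) (d := .left) rfl (.single (y := some v) (d := .stay) rfl)

/-! ## Simulation of a Turing machine -/

/-- The number of steps in which a machine that decides inputs of length `n` within `m` steps is
simulated by means of codes of length `s`: conversion of the input, `m` simulated steps, erasing,
and search for the first cell. -/
def simTime (s n m : ℕ) : ℕ :=
  (n * (2 * n + 2 * (s * n) + 6) + 1) + m * (3 * s + 2) + (2 * (s * (n + m)) + 2) + (3 * n + 2)

theorem reaches_halt_of_decidesInTime {F : List Bool → Bool} {T : ℕ → ℕ}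
    (hM : M.DecidesInTime F T) (w : List Bool) :
    (simAuto M C).Reaches (simTime C.size w.length (T w.length)) (.goto load) ⟨[], w.map some⟩
      .halt ⟨[], [some (F w)]⟩ := by
  obtain ⟨m, hm, hstate⟩ := hM w
  have hload : (simAuto M C).Reaches
      (w.length * (2 * w.length + 2 * (C.size * w.length) + 6) + 1) (.goto load)
      ⟨[], w.map some⟩ (.goto (enter M M.start))
      (C.encodeTape w.length ⟨[], w.map M.bit⟩) := by
    have := reaches_enter_of_load (M := M) (C := C) (i := 0) (w := w) (E := []) le_rfl
    rw [zero_add, List.length_nil, zero_add] at this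
    exact this.congr_left (Zipper.tape_append_replicate [] (w.map some) 1).symm
  obtain ⟨Z, hlen, hrun⟩ := exists_reaches_seekEnd (C := C) w.length m M.start
    ⟨[], w.map M.bit⟩ (F w) hstate
  refine (((hload.trans hrun).trans (reaches_probe_of_seekEnd (F w) w.length Z)).trans
    (reaches_halt_of_probe (F w) w.length)).mono ?_
  rw [List.length_nil, List.length_map, zero_add] at hlen
  have hsteps : m * (3 * C.size + 2) ≤ T w.length * (3 * C.size + 2) := Nat.mul_le_mul_right _ hm
  have herase : C.size * (Z.left.length + Z.right.length) ≤ C.size * (w.length + T w.length) :=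
    Nat.mul_le_mul_left _ (by omega)
  rw [simTime]
  omega

theorem simTime_mem_poly (s : ℕ) {T : ℕ → ℕ} (hT : T ∈ poly) :
    (fun n => 4 * simTime s n (T n)) ∈ poly := by
  obtain ⟨p, hp⟩ := hT
  open Polynomial in
  refine ⟨4 * ((X * (2 * X + 2 * ((s : ℝ[X]) * X) + 6) + 1) + p * (3 * (s : ℝ[X]) + 2) +
    (2 * ((s : ℝ[X]) * (X + p)) + 2) + (3 * X + 2)), fun n => ?_⟩
  simp [simTime, hp]

theorem exists_program_of_mem_ClassP {F : List Bool → Bool} (hF : F ∈ ClassP) :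
    ∃ t ∈ TMPrograms, ∃ T ∈ poly, ComputesInTime t (ofDecision F) T := by
  obtain ⟨M, T, hT, hM⟩ := hF
  have := M.finQ
  have := M.finΓ
  have : Nonempty M.Γ := ⟨M.blank⟩
  obtain ⟨C⟩ := nonempty_coding M.Γ
  obtain ⟨t, ht, hfoci, hexec⟩ := exists_mem_TMPrograms_executes (A := simAuto M C) (q₀ := load)
    (finite_setOf_bounded C.size M.Q) trivial fun _ hs => bounded_of_simAuto_eq_goto M C hs
  exact ⟨t, ht, _, simTime_mem_poly C.size hT,
    hexec.computesInTime hfoci fun w => reaches_halt_of_decidesInTime hM w⟩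

end

end PGA

theorem mainTheorem2 :
    PGA.ClassP =
      {F : List Bool → Bool | ∃ t ∈ PGA.TMPrograms, ∃ T ∈ PGA.poly,
        PGA.ComputesInTime t (PGA.ofDecision F) T} := by
  ext F
  refine ⟨PGA.exists_program_of_mem_ClassP, ?_⟩
  rintro ⟨t, ht, T, hT, h⟩
  exact PGA.mem_ClassP_of_computesInTime ht hT h
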